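/- **Theorem 3.1.** Let $k\in\mathbb N$. For $\lambda\in\mathbb R^k$ put $e_\lambda(x)=e^{i\langle\lambda,x\rangle}$, $x\in\mathbb R^k$, and let $AP^k$ be the closed subalgebra, with respect to the supremum norm, generated by the functions $e_\lambda$ ($\lambda\in\mathbb R^k$) in the algebra of bounded continuous functions $\mathbb R^k\to\mathbb C$. For $f\in AP^k$ let $$f_\lambda=\lim_{T\to\infty}\frac1{(2T)^k}\int_{[-T,T]^k}e^{-i\langle\lambda,x\rangle}f(x)\,dx,\qquad \sigma(f)=\{\lambda\in\mathbb R^k: f_\lambda\ne0\}$$ be its Bohr–Fourier coefficients and its Bohr–Fourier spectrum, and let $APW^k=\{f\in AP^k:\sum_{\lambda}|f_\lambda|<\infty\}$, which is a Banach algebra with the norm $\|f\|_W=\sum_\lambda|f_\lambda|$. A set $S\subseteq\mathbb R^k$ is a *halfspace* if $\mathbb R^k=S\cup(-S)$, $S\cap(-S)=\{0\}$, $\lambda+\mu\in S$ for all $\lambda,\mu\in S$, and $\alpha\lambda\in S$ for all $\lambda\in S$ and all real $\alpha\ge0$. Let $S\subset\mathbb R^k$ be a halfspace and let $\Sigma\subseteq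 S$ be an additive semigroup (that is, $\lambda+\mu\in\Sigma$ for all $\lambda,\mu\in\Sigma$) containing $0$. Consider the commutative unital Banach algebras $$AP^k_\Sigma=\{f\in AP^k:\sigma(f)\subseteq\Sigma\},\qquad APW^k_\Sigma=\{f\in APW^k:\sigma(f)\subseteq\Sigma\},$$ with the norms $\|\cdot\|_\infty$ and $\|\cdot\|_W$ respectively. Then the maximal ideal spaces $\mathbb M(AP^k_\Sigma)$ and $\mathbb M(APW^k_\Sigma)$ are contractible. Here the maximal ideal space $\mathbb M(\mathcal A)$ of a commutative unital Banach algebra $\mathcal A$ is the set of all nonzero multiplicative linear functionals $\phi:\mathcal A\to\mathbb C$ (these are automatically bounded), with the topology induced by the weak$^*$ topology of the dual space $\mathcal A^*$. -/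

import Mathlib

open Filter Topology MeasureTheory
open scoped BoundedContinuousFunction Pointwise

noncomputable section

namespace AlmostPeriodic

variable {k : ℕ}

/-- A halfspace of `ℝ^k`: the nonnegative cone of a total vector order. -/
structure IsHalfspace (S : Set (Fin k → ℝ)) : Prop where
  union_neg : S ∪ -S = Set.univ
  inter_neg : S ∩ -S = {0}
  add_mem : ∀ l ∈ S, ∀ m ∈ S, l + m ∈ S
  smul_mem : ∀ l ∈ S, ∀ a : ℝ, 0 ≤ a → a • l ∈ S

/-- The elementary exponential `x ↦ exp (i ⟨l, x⟩)`. -/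
def expo (l : Fin k → ℝ) : (Fin k → ℝ) →ᵇ ℂ :=
  BoundedContinuousFunction.ofNormedAddCommGroup
    (fun x => Complex.exp (Complex.I * ((l ⬝ᵥ x : ℝ) : ℂ)))
    (by unfold dotProduct; fun_prop) 1
    (fun x => by rw [mul_comm, Complex.norm_exp_ofReal_mul_I])

/-- The algebra `AP^k` of almost periodic functions on `ℝ^k`: the closed subalgebra, for the
supremum norm, generated by the elementary exponentials. -/
def AP (k : ℕ) : Subalgebra ℂ ((Fin k → ℝ) →ᵇ ℂ) :=
  (Algebra.adjoin ℂ (Set.range (expo (k := k)))).topologicalClosure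

/-- The average of `f` over the cube `[-T, T]^k`. -/
def cubeAvg (f : (Fin k → ℝ) → ℂ) (T : ℝ) : ℂ :=
  ((1 / (2 * T) ^ k : ℝ) : ℂ) *
    ∫ x in Set.Icc (fun _ : Fin k => -T) (fun _ : Fin k => T), f x

/-- The Bohr mean: the limit of the averages over the cubes `[-T, T]^k` as `T → ∞`.
The limit exists for every almost periodic function, see `tendsto_cubeAvg`. -/
def bohrMean (f : (Fin k → ℝ) → ℂ) : ℂ := limUnder atTop (cubeAvg f)

/-- The Bohr-Fourier coefficient `f_l`. -/
def bohrCoeff (f : (Fin k → ℝ) → ℂ) (l : Fin k → ℝ) : ℂ :=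
  bohrMean fun x => Complex.exp (-(Complex.I * ((l ⬝ᵥ x : ℝ) : ℂ))) * f x

/-- The Bohr-Fourier spectrum `σ(f)`. -/
def bohrSpectrum (f : (Fin k → ℝ) → ℂ) : Set (Fin k → ℝ) := {l | bohrCoeff f l ≠ 0}

/-! Facts needed to see that prescribing the spectrum cuts out subalgebras. -/

lemma expo_apply (l x : Fin k → ℝ) :
    expo l x = Complex.exp (Complex.I * ((l ⬝ᵥ x : ℝ) : ℂ)) := rfl

lemma expo_zero : expo (0 : Fin k → ℝ) = 1 := by
  ext x; simp [expo_apply]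

lemma expo_add (l m : Fin k → ℝ) : expo (l + m) = expo l * expo m := by
  ext x
  simp [expo_apply, add_dotProduct, mul_add, Complex.exp_add]

lemma star_expo (l : Fin k → ℝ) : star (expo l) = expo (-l) := by
  ext x
  simp [expo_apply, ← Complex.exp_conj]

lemma expo_mem (l : Fin k → ℝ) : expo l ∈ AP k :=
  Subalgebra.le_topologicalClosure _ (Algebra.subset_adjoin ⟨l, rfl⟩)

lemma adjoin_eq_span : Subalgebra.toSubmodule (Algebra.adjoin ℂ (Set.range (expo (k := k))))
    = Submodule.span ℂ (Set.range (expo (k := k))) := by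
  have h : (Submonoid.closure (Set.range (expo (k := k))) : Set _)
      = Set.range (expo (k := k)) := by
    apply Set.Subset.antisymm _ Submonoid.subset_closure
    let N : Submonoid ((Fin k → ℝ) →ᵇ ℂ) :=
      { carrier := Set.range (expo (k := k))
        one_mem' := ⟨0, expo_zero⟩
        mul_mem' := by
          rintro _ _ ⟨l, rfl⟩ ⟨m, rfl⟩
          exact ⟨l + m, expo_add l m⟩ }
    exact (Submonoid.closure_le (S := N)).2 subset_rfl
  rw [Algebra.adjoin_eq_span, h]

lemma mem_AP_iff {f : (Fin k → ℝ) →ᵇ ℂ} :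
    f ∈ AP k ↔ f ∈ closure (Submodule.span ℂ (Set.range (expo (k := k))) : Set _) := by
  rw [← adjoin_eq_span]; rfl

lemma star_mem {f : (Fin k → ℝ) →ᵇ ℂ} (hf : f ∈ AP k) : star f ∈ AP k := by
  rw [mem_AP_iff] at hf ⊢
  refine map_mem_closure (continuous_star) hf ?_
  intro p hp
  induction hp using Submodule.span_induction with
  | mem x hx =>
    obtain ⟨l, rfl⟩ := hx
    rw [star_expo]; exact Submodule.subset_span ⟨_, rfl⟩
  | zero => simp
  | add x y _ _ hx hy => rw [star_add]; exact Submodule.add_mem _ hx hy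
  | smul c x _ hx => rw [star_smul]; exact Submodule.smul_mem _ _ hx

lemma volume_cube {T : ℝ} (hT : 0 < T) :
    volume.real (Set.Icc (fun _ : Fin k => -T) (fun _ : Fin k => T)) = (2 * T) ^ k := by
  rw [Measure.real, Real.volume_Icc_pi_toReal (fun _ => by linarith)]
  simp; ring_nf

lemma norm_cubeAvg_le {f : (Fin k → ℝ) → ℂ} {C T : ℝ} (hT : 0 < T) (hf : ∀ x, ‖f x‖ ≤ C) :
    ‖cubeAvg f T‖ ≤ C := by
  have h := norm_setIntegral_le_of_norm_le_const (μ := volume)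
    (s := Set.Icc (fun _ : Fin k => -T) (fun _ : Fin k => T)) (f := f) (C := C)
    isCompact_Icc.measure_lt_top (fun x _ => hf x)
  rw [volume_cube hT] at h
  have hp : 0 < (2 * T) ^ k := by positivity
  rw [cubeAvg, norm_mul, Complex.norm_real, Real.norm_of_nonneg (by positivity),
    one_div, inv_mul_le_iff₀ hp]
  linarith

lemma integrableOn_cube (f : (Fin k → ℝ) →ᵇ ℂ) (T : ℝ) :
    IntegrableOn f (Set.Icc (fun _ : Fin k => -T) (fun _ : Fin k => T)) :=
  f.continuous.integrableOn_Icc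

lemma cubeAvg_add (f g : (Fin k → ℝ) →ᵇ ℂ) (T : ℝ) :
    cubeAvg (f + g : (Fin k → ℝ) →ᵇ ℂ) T = cubeAvg f T + cubeAvg g T := by
  simp only [cubeAvg, BoundedContinuousFunction.coe_add, Pi.add_apply]
  rw [integral_add (integrableOn_cube f T) (integrableOn_cube g T), mul_add]

lemma cubeAvg_smul (c : ℂ) (f : (Fin k → ℝ) →ᵇ ℂ) (T : ℝ) :
    cubeAvg (c • f : (Fin k → ℝ) →ᵇ ℂ) T = c * cubeAvg f T := by
  simp only [cubeAvg, BoundedContinuousFunction.coe_smul, smul_eq_mul]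
  rw [integral_const_mul]; ring

lemma cubeAvg_sub (f g : (Fin k → ℝ) →ᵇ ℂ) (T : ℝ) :
    cubeAvg (f - g : (Fin k → ℝ) →ᵇ ℂ) T = cubeAvg f T - cubeAvg g T := by
  have := cubeAvg_add f ((-1 : ℂ) • g) T
  rw [cubeAvg_smul] at this
  rw [show f - g = f + (-1 : ℂ) • g by rw [neg_one_smul, sub_eq_add_neg], this]; ring

lemma tendsto_avg_exp (a : ℝ) :
    Tendsto (fun T : ℝ => ((1 / (2 * T) : ℝ) : ℂ) *
      ∫ x in Set.Icc (-T) T, Complex.exp (Complex.I * ((a * x : ℝ) : ℂ))) atTop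
      (𝓝 (if a = 0 then 1 else 0)) := by
  split_ifs with h
  · subst h
    refine tendsto_const_nhds.congr' ?_
    filter_upwards [eventually_gt_atTop 0] with T hT
    have : (T : ℂ) ≠ 0 := by exact_mod_cast hT.ne'
    simp [hT.le]
    field_simp
    norm_num
  · rw [tendsto_zero_iff_norm_tendsto_zero]
    have hlim : Tendsto (fun T : ℝ => |a|⁻¹ * T⁻¹) atTop (𝓝 0) := by
      simpa using tendsto_inv_atTop_zero.const_mul (|a|⁻¹)
    refine squeeze_zero' (Eventually.of_forall fun _ => norm_nonneg _) ?_ hlim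
    filter_upwards [eventually_gt_atTop 0] with T hT
    have hc : Complex.I * a ≠ 0 := by simp [h]
    have hI : ∫ x in Set.Icc (-T) T, Complex.exp (Complex.I * ((a * x : ℝ) : ℂ))
        = (Complex.exp (Complex.I * a * T) - Complex.exp (Complex.I * a * (-T : ℝ)))
          / (Complex.I * a) := by
      rw [integral_Icc_eq_integral_Ioc, ← intervalIntegral.integral_of_le (by linarith),
        ← integral_exp_mul_complex hc]
      congr 1; ext x; push_cast; ring_nf
    have h1 : ∀ y : ℝ, ‖Complex.exp (Complex.I * a * y)‖ = 1 := fun y => by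
      rw [show Complex.I * a * y = ((a * y : ℝ) : ℂ) * Complex.I by push_cast; ring,
        Complex.norm_exp_ofReal_mul_I]
    rw [hI, norm_mul, norm_div, Complex.norm_real, norm_mul, Complex.norm_I, one_mul,
      Complex.norm_real, Real.norm_of_nonneg (by positivity), Real.norm_eq_abs]
    have h2 : ‖Complex.exp (Complex.I * a * T) - Complex.exp (Complex.I * a * (-T : ℝ))‖ ≤ 2 := by
      refine (norm_sub_le _ _).trans ?_
      rw [h1, h1]; norm_num
    have ha : 0 < |a| := abs_pos.2 h
    calc 1 / (2 * T) * (_ / |a|) ≤ 1 / (2 * T) * (2 / |a|) := by gcongr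
      _ = |a|⁻¹ * T⁻¹ := by field_simp

lemma tendsto_cubeAvg_expo (l : Fin k → ℝ) :
    Tendsto (cubeAvg (expo l)) atTop (𝓝 (if l = 0 then 1 else 0)) := by
  have h := tendsto_finsetProd (Finset.univ : Finset (Fin k))
    (fun i _ => tendsto_avg_exp (l i))
  have h2 : (∏ i : Fin k, (if l i = 0 then (1 : ℂ) else 0)) = if l = 0 then 1 else 0 := by
    split_ifs with hl
    · subst hl; simp
    · obtain ⟨i, hi⟩ : ∃ i, l i ≠ 0 := by
        by_contra! hc; exact hl (funext hc)
      exact Finset.prod_eq_zero (Finset.mem_univ i) (by simp [hi])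
  rw [h2] at h
  refine h.congr fun T => ?_
  rw [Finset.prod_mul_distrib, cubeAvg]
  congr 1
  · simp [mul_pow, mul_comm]
  · rw [← Set.pi_univ_Icc, volume_pi, Measure.restrict_pi_pi, ← integral_fintype_prod_eq_prod]
    congr 1; ext x
    rw [expo_apply, ← Complex.exp_sum, ← Finset.mul_sum]
    simp [dotProduct]

lemma exists_tendsto_cubeAvg {f : (Fin k → ℝ) →ᵇ ℂ} (hf : f ∈ AP k) :
    ∃ m, Tendsto (cubeAvg f) atTop (𝓝 m) := by
  have hspan : ∀ p ∈ Submodule.span ℂ (Set.range (expo (k := k))),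
      ∃ m, Tendsto (cubeAvg p) atTop (𝓝 m) := by
    intro p hp
    induction hp using Submodule.span_induction with
    | mem x hx => obtain ⟨l, rfl⟩ := hx; exact ⟨_, tendsto_cubeAvg_expo l⟩
    | zero =>
      refine ⟨0, ?_⟩
      have : cubeAvg (0 : (Fin k → ℝ) →ᵇ ℂ) = fun _ => (0 : ℂ) := by
        ext T; simp [cubeAvg]
      rw [this]; exact tendsto_const_nhds
    | add x y _ _ hx hy =>
      obtain ⟨a, ha⟩ := hx
      obtain ⟨b, hb⟩ := hy
      exact ⟨a + b, (ha.add hb).congr fun T => (cubeAvg_add x y T).symm⟩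
    | smul c x _ hx =>
      obtain ⟨a, ha⟩ := hx
      exact ⟨c * a, (ha.const_mul c).congr fun T => (cubeAvg_smul c x T).symm⟩
  rw [mem_AP_iff, Metric.mem_closure_iff] at hf
  apply cauchy_map_iff_exists_tendsto.1
  rw [Metric.cauchy_iff]
  refine ⟨inferInstance, fun ε hε => ?_⟩
  obtain ⟨p, hp, hfp⟩ := hf (ε / 4) (by linarith)
  obtain ⟨m, hm⟩ := hspan p hp
  refine ⟨Metric.ball m (ε / 2), ?_, ?_⟩
  · rw [Filter.mem_map]
    filter_upwards [hm (Metric.ball_mem_nhds m (show 0 < ε / 4 by linarith)),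
      eventually_gt_atTop (0 : ℝ)] with T hT hT0
    have h1 : ‖cubeAvg (f - p : (Fin k → ℝ) →ᵇ ℂ) T‖ ≤ ‖f - p‖ :=
      norm_cubeAvg_le hT0 (fun x => (f - p).norm_coe_le_norm x)
    rw [cubeAvg_sub] at h1
    rw [dist_eq_norm] at hfp
    have h3 : dist (cubeAvg p T) m < ε / 4 := hT
    have h4 := dist_triangle (cubeAvg f T) (cubeAvg p T) m
    rw [dist_eq_norm (cubeAvg f T)  (cubeAvg p T)] at h4
    change dist _ _ < _
    linarith
  · intro x hx y hy
    have := dist_triangle_right x y m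
    rw [Metric.mem_ball] at hx hy
    linarith

/-- The limit in the definition of the Bohr mean exists for almost periodic functions. -/
lemma tendsto_cubeAvg {f : (Fin k → ℝ) →ᵇ ℂ} (hf : f ∈ AP k) :
    Tendsto (cubeAvg f) atTop (𝓝 (bohrMean f)) :=
  tendsto_nhds_limUnder (exists_tendsto_cubeAvg hf)

lemma bohrMean_add {f g : (Fin k → ℝ) →ᵇ ℂ} (hf : f ∈ AP k) (hg : g ∈ AP k) :
    bohrMean (f + g : (Fin k → ℝ) →ᵇ ℂ) = bohrMean f + bohrMean g :=
  tendsto_nhds_unique (tendsto_cubeAvg (add_mem hf hg))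
    (((tendsto_cubeAvg hf).add (tendsto_cubeAvg hg)).congr fun T => (cubeAvg_add f g T).symm)

lemma bohrMean_sub {f g : (Fin k → ℝ) →ᵇ ℂ} (hf : f ∈ AP k) (hg : g ∈ AP k) :
    bohrMean (f - g : (Fin k → ℝ) →ᵇ ℂ) = bohrMean f - bohrMean g :=
  tendsto_nhds_unique (tendsto_cubeAvg (sub_mem hf hg))
    (((tendsto_cubeAvg hf).sub (tendsto_cubeAvg hg)).congr fun T => (cubeAvg_sub f g T).symm)

lemma bohrMean_smul (c : ℂ) {f : (Fin k → ℝ) →ᵇ ℂ} (hf : f ∈ AP k) :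
    bohrMean (c • f : (Fin k → ℝ) →ᵇ ℂ) = c * bohrMean f :=
  tendsto_nhds_unique (tendsto_cubeAvg ((AP k).smul_mem hf c))
    (((tendsto_cubeAvg hf).const_mul c).congr fun T => (cubeAvg_smul c f T).symm)

lemma bohrMean_expo (l : Fin k → ℝ) : bohrMean (expo l) = if l = 0 then 1 else 0 :=
  tendsto_nhds_unique (tendsto_cubeAvg (expo_mem l)) (tendsto_cubeAvg_expo l)

lemma bohrMean_sum {ι : Type*} (F : Finset ι) (f : ι → (Fin k → ℝ) →ᵇ ℂ)
    (hf : ∀ i, f i ∈ AP k) :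
    bohrMean (∑ i ∈ F, f i : (Fin k → ℝ) →ᵇ ℂ) = ∑ i ∈ F, bohrMean (f i) := by
  classical
  induction F using Finset.induction_on with
  | empty => simpa using bohrMean_smul 0 (zero_mem (AP k))
  | insert a F ha ih =>
    rw [Finset.sum_insert ha, Finset.sum_insert ha,
      bohrMean_add (hf a) (sum_mem fun i _ => hf i), ih]

lemma norm_bohrMean_le {f : (Fin k → ℝ) →ᵇ ℂ} (hf : f ∈ AP k) : ‖bohrMean f‖ ≤ ‖f‖ :=
  le_of_tendsto (tendsto_cubeAvg hf).norm <| by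
    filter_upwards [eventually_gt_atTop 0] with T hT
    exact norm_cubeAvg_le hT f.norm_coe_le_norm

lemma bohrMean_star {f : (Fin k → ℝ) →ᵇ ℂ} (hf : f ∈ AP k) :
    bohrMean (star f : (Fin k → ℝ) →ᵇ ℂ) = star (bohrMean f) := by
  refine tendsto_nhds_unique (tendsto_cubeAvg (star_mem hf))
    ((tendsto_cubeAvg hf).star.congr fun T => ?_)
  simp only [cubeAvg, BoundedContinuousFunction.coe_star, Pi.star_apply, RCLike.star_def,
    map_mul, Complex.conj_ofReal, integral_conj]

lemma bohrCoeff_eq (f : (Fin k → ℝ) →ᵇ ℂ) (l : Fin k → ℝ) :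
    bohrCoeff f l = bohrMean (expo (-l) * f : (Fin k → ℝ) →ᵇ ℂ) := by
  unfold bohrCoeff
  congr 1; ext x
  simp [expo_apply]

lemma bohrCoeff_expo (l m : Fin k → ℝ) :
    bohrCoeff (expo l) m = if l = m then 1 else 0 := by
  rw [bohrCoeff_eq, ← expo_add, bohrMean_expo]
  simp only [neg_add_eq_zero, eq_comm]

lemma bohrCoeff_add {f g : (Fin k → ℝ) →ᵇ ℂ} (hf : f ∈ AP k) (hg : g ∈ AP k)
    (l : Fin k → ℝ) :
    bohrCoeff (f + g : (Fin k → ℝ) →ᵇ ℂ) l = bohrCoeff f l + bohrCoeff g l := by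
  simp only [bohrCoeff_eq]
  rw [mul_add, bohrMean_add (mul_mem (expo_mem _) hf) (mul_mem (expo_mem _) hg)]

lemma bohrCoeff_smul (c : ℂ) {f : (Fin k → ℝ) →ᵇ ℂ} (hf : f ∈ AP k) (l : Fin k → ℝ) :
    bohrCoeff (c • f : (Fin k → ℝ) →ᵇ ℂ) l = c * bohrCoeff f l := by
  simp only [bohrCoeff_eq]
  rw [mul_smul_comm, bohrMean_smul c (mul_mem (expo_mem _) hf)]

/-- The distance, in quadratic mean, from `u` to a trigonometric polynomial. -/
lemma bohrMean_star_sub_mul_sub {u : (Fin k → ℝ) →ᵇ ℂ} (hu : u ∈ AP k)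
    (F : Finset (Fin k → ℝ)) (c : (Fin k → ℝ) → ℂ) :
    (bohrMean (star (u - ∑ m ∈ F, c m • expo m) * (u - ∑ m ∈ F, c m • expo m) :
      (Fin k → ℝ) →ᵇ ℂ)).re
    = (bohrMean (star u * u : (Fin k → ℝ) →ᵇ ℂ)).re - ∑ m ∈ F, ‖bohrCoeff u m‖ ^ 2
      + ∑ m ∈ F, ‖bohrCoeff u m - c m‖ ^ 2 := by
  classical
  set p := ∑ m ∈ F, c m • expo m with hp
  have hpm : p ∈ AP k := sum_mem fun m _ => (AP k).smul_mem (expo_mem m) _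
  have hps : ∀ g ∈ AP k, bohrMean (star p * g : (Fin k → ℝ) →ᵇ ℂ)
      = ∑ m ∈ F, star (c m) * bohrCoeff g m := by
    intro g hg
    have : star p * g = ∑ m ∈ F, star (c m) • (expo (-m) * g) := by
      rw [hp, star_sum, Finset.sum_mul]
      refine Finset.sum_congr rfl fun m _ => ?_
      rw [star_smul, star_expo, smul_mul_assoc]
    rw [this, bohrMean_sum _ _ fun m => (AP k).smul_mem (mul_mem (expo_mem _) hg) _]
    refine Finset.sum_congr rfl fun m _ => ?_
    rw [bohrMean_smul _ (mul_mem (expo_mem _) hg), bohrCoeff_eq]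
  have hpc : ∀ m ∈ F, bohrCoeff p m = c m := by
    intro m hm
    rw [bohrCoeff_eq, hp, Finset.mul_sum,
      bohrMean_sum _ _ fun m => mul_mem (expo_mem _) ((AP k).smul_mem (expo_mem _) _)]
    have : ∀ n ∈ F, bohrMean (expo (-m) * c n • expo n : (Fin k → ℝ) →ᵇ ℂ)
        = if n = m then c n else 0 := by
      intro n _
      rw [mul_smul_comm, bohrMean_smul _ (mul_mem (expo_mem _) (expo_mem _)),
        ← bohrCoeff_eq, bohrCoeff_expo]
      simp
    rw [Finset.sum_congr rfl this]
    simp [hm]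
  have e1 : star (u - p) * (u - p) = star u * u - star p * u - star (star p * u) + star p * p := by
    rw [star_sub, star_mul, star_star]; ring
  have su := star_mem hu
  have sp := star_mem hpm
  have hpp : ∑ m ∈ F, star (c m) * bohrCoeff p m = ∑ m ∈ F, star (c m) * c m :=
    Finset.sum_congr rfl fun m hm => by rw [hpc m hm]
  have m1 := mul_mem su hu
  have m2 := mul_mem sp hu
  have m3 := star_mem m2
  rw [e1, bohrMean_add (sub_mem (sub_mem m1 m2) m3) (mul_mem sp hpm),
    bohrMean_sub (sub_mem m1 m2) m3, bohrMean_sub m1 m2, bohrMean_star m2, hps u hu, hps p hpm,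
    hpp]
  simp only [Complex.add_re, Complex.sub_re, RCLike.star_def, Complex.conj_re, Complex.re_sum]
  rw [sub_sub, sub_add, sub_add, sub_right_inj, ← Finset.sum_add_distrib,
    ← Finset.sum_sub_distrib, ← Finset.sum_sub_distrib]
  refine Finset.sum_congr rfl fun m _ => ?_
  rw [← Complex.normSq_eq_norm_sq, ← Complex.normSq_eq_norm_sq]
  simp only [Complex.normSq_apply, Complex.mul_re, Complex.conj_re, Complex.conj_im,
    Complex.sub_re, Complex.sub_im]
  ring

lemma norm_bohrMean_mul_le {w v : (Fin k → ℝ) →ᵇ ℂ} (hw : w ∈ AP k) (hv : v ∈ AP k) {ε : ℝ}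
    (hε : 0 < ε) (h : (bohrMean (star w * w : (Fin k → ℝ) →ᵇ ℂ)).re ≤ ε ^ 2) :
    ‖bohrMean (w * v : (Fin k → ℝ) →ᵇ ℂ)‖ ≤ ‖v‖ * ε := by
  have hww := mul_mem (star_mem hw) hw
  have hlim : Tendsto (fun T => ‖v‖ * (ε / 2 +
      (cubeAvg (star w * w : (Fin k → ℝ) →ᵇ ℂ) T).re / (2 * ε))) atTop
      (𝓝 (‖v‖ * (ε / 2 + (bohrMean (star w * w : (Fin k → ℝ) →ᵇ ℂ)).re / (2 * ε)))) :=
    ((((Complex.continuous_re.tendsto _).comp (tendsto_cubeAvg hww)).div_const _).const_add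
      _).const_mul _
  have hle : ‖bohrMean (w * v : (Fin k → ℝ) →ᵇ ℂ)‖
      ≤ ‖v‖ * (ε / 2 + (bohrMean (star w * w : (Fin k → ℝ) →ᵇ ℂ)).re / (2 * ε)) := by
    refine le_of_tendsto_of_tendsto (tendsto_cubeAvg (mul_mem hw hv)).norm hlim ?_
    filter_upwards [eventually_gt_atTop 0] with T hT
    set Q := Set.Icc (fun _ : Fin k => -T) (fun _ : Fin k => T) with hQ
    have hp : 0 < (2 * T) ^ k := by positivity
    have hre : (cubeAvg (star w * w : (Fin k → ℝ) →ᵇ ℂ) T).re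
        = 1 / (2 * T) ^ k * ∫ x in Q, ‖w x‖ ^ 2 := by
      rw [cubeAvg, Complex.re_ofReal_mul]
      congr 1
      have : ∀ x, (star w * w : (Fin k → ℝ) →ᵇ ℂ) x = ((‖w x‖ ^ 2 : ℝ) : ℂ) := fun x => by
        simp [Complex.conj_mul']
      simp_rw [this]
      rw [integral_complex_ofReal, Complex.ofReal_re]
    have hi : IntegrableOn (fun x => ‖w x‖ ^ 2) Q :=
      (w.continuous.norm.pow 2).integrableOn_Icc
    have hc : IntegrableOn (fun _ : Fin k → ℝ => ε / 2) Q := continuous_const.integrableOn_Icc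
    have hpt : ‖∫ x in Q, (w * v : (Fin k → ℝ) →ᵇ ℂ) x‖
        ≤ ∫ x in Q, ‖v‖ * (ε / 2 + ‖w x‖ ^ 2 / (2 * ε)) := by
      refine norm_integral_le_of_norm_le ((hc.add (hi.div_const _)).const_mul _)
        (Eventually.of_forall fun x => ?_)
      have h1 := v.norm_coe_le_norm x
      have h2 : ‖w x‖ ≤ ε / 2 + ‖w x‖ ^ 2 / (2 * ε) := by
        have h3 : ε / 2 + ‖w x‖ ^ 2 / (2 * ε) - ‖w x‖ = (ε - ‖w x‖) ^ 2 / (2 * ε) := by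
          field_simp; ring
        have h4 : 0 ≤ (ε - ‖w x‖) ^ 2 / (2 * ε) := by positivity
        linarith
      rw [BoundedContinuousFunction.coe_mul, Pi.mul_apply, norm_mul, mul_comm]
      exact mul_le_mul h1 h2 (norm_nonneg _) (norm_nonneg _)
    rw [integral_const_mul, integral_add hc (hi.div_const (2 * ε)),
      integral_div (2 * ε) (fun x => ‖w x‖ ^ 2),
      setIntegral_const, volume_cube hT, smul_eq_mul] at hpt
    rw [hre, cubeAvg, norm_mul, Complex.norm_real, Real.norm_of_nonneg (by positivity)]
    calc _ ≤ 1 / (2 * T) ^ k * _ := mul_le_mul_of_nonneg_left hpt (by positivity)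
      _ = _ := by field_simp
  refine hle.trans (mul_le_mul_of_nonneg_left ?_ (norm_nonneg _))
  have : (bohrMean (star w * w : (Fin k → ℝ) →ᵇ ℂ)).re / (2 * ε) ≤ ε ^ 2 / (2 * ε) := by gcongr
  have h5 : ε ^ 2 / (2 * ε) = ε / 2 := by field_simp
  linarith

/-- Parseval's formula. -/
lemma hasSum_bohrMean_mul {u v : (Fin k → ℝ) →ᵇ ℂ} (hu : u ∈ AP k) (hv : v ∈ AP k) :
    HasSum (fun m => bohrCoeff u m * bohrCoeff v (-m))
      (bohrMean (u * v : (Fin k → ℝ) →ᵇ ℂ)) := by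
  classical
  rw [HasSum, SummationFilter.unconditional_filter, Metric.tendsto_atTop]
  intro ε hε
  set δ := ε / (‖v‖ + 1) with hδ
  have hv0 := norm_nonneg v
  have hδ0 : 0 < δ := by positivity
  obtain ⟨p, hp, hup⟩ := Metric.mem_closure_iff.1 (mem_AP_iff.1 hu) δ hδ0
  obtain ⟨c, rfl⟩ := Finsupp.mem_span_range_iff_exists_finsupp.1 hp
  refine ⟨c.support, fun F hF => ?_⟩
  have hcF : (c.sum fun i a => a • expo i) = ∑ m ∈ F, c m • expo m :=
    Finset.sum_subset hF fun m _ hm => by simp [Finsupp.notMem_support_iff.1 hm]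
  rw [hcF, dist_eq_norm] at hup
  set w := u - ∑ m ∈ F, bohrCoeff u m • expo m with hw
  have hsm : ∀ a : (Fin k → ℝ) → ℂ, ∑ m ∈ F, a m • expo m ∈ AP k := fun a =>
    sum_mem fun m _ => (AP k).smul_mem (expo_mem m) _
  have hwm : w ∈ AP k := sub_mem hu (hsm _)
  have hw2 : (bohrMean (star w * w : (Fin k → ℝ) →ᵇ ℂ)).re ≤ δ ^ 2 := by
    have h1 := bohrMean_star_sub_mul_sub hu F (fun m => bohrCoeff u m)
    have h2 := bohrMean_star_sub_mul_sub hu F c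
    have h3 : 0 ≤ ∑ m ∈ F, ‖bohrCoeff u m - c m‖ ^ 2 := Finset.sum_nonneg fun _ _ => by positivity
    set q := u - ∑ m ∈ F, c m • expo m with hq
    have hqm : q ∈ AP k := sub_mem hu (hsm _)
    have h4 : (bohrMean (star q * q : (Fin k → ℝ) →ᵇ ℂ)).re ≤ ‖q‖ ^ 2 := by
      refine (Complex.re_le_norm _).trans ((norm_bohrMean_le (mul_mem (star_mem hqm) hqm)).trans ?_)
      refine (norm_mul_le _ _).trans ?_
      rw [norm_star, sq]
    have h5 : ‖q‖ ^ 2 ≤ δ ^ 2 := by gcongr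
    rw [← hw] at h1
    simp only [sub_self, norm_zero] at h1
    simp only [ne_eq, OfNat.ofNat_ne_zero, not_false_eq_true, zero_pow, Finset.sum_const_zero,
      add_zero] at h1
    linarith
  have hmean : bohrMean (w * v : (Fin k → ℝ) →ᵇ ℂ) = bohrMean (u * v : (Fin k → ℝ) →ᵇ ℂ)
      - ∑ m ∈ F, bohrCoeff u m * bohrCoeff v (-m) := by
    rw [hw, sub_mul, bohrMean_sub (mul_mem hu hv) (mul_mem (hsm _) hv), Finset.sum_mul,
      bohrMean_sum _ _ fun m => mul_mem ((AP k).smul_mem (expo_mem m) _) hv]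
    congr 1
    refine Finset.sum_congr rfl fun m _ => ?_
    rw [smul_mul_assoc, bohrMean_smul _ (mul_mem (expo_mem _) hv), bohrCoeff_eq v, neg_neg]
  have hfin := norm_bohrMean_mul_le hwm hv hδ0 hw2
  rw [hmean] at hfin
  rw [dist_comm, dist_eq_norm]
  refine hfin.trans_lt ?_
  rw [hδ, mul_div_assoc', div_lt_iff₀ (by positivity)]
  nlinarith

/-- The coefficients of a product are the convolution of the coefficients. -/
lemma hasSum_bohrCoeff_mul {f g : (Fin k → ℝ) →ᵇ ℂ} (hf : f ∈ AP k) (hg : g ∈ AP k)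
    (l : Fin k → ℝ) :
    HasSum (fun m => bohrCoeff f m * bohrCoeff g (l - m))
      (bohrCoeff (f * g : (Fin k → ℝ) →ᵇ ℂ) l) := by
  have h := hasSum_bohrMean_mul hf (mul_mem (expo_mem (-l)) hg)
  rw [mul_left_comm, ← bohrCoeff_eq] at h
  convert h using 3 with m
  rw [bohrCoeff_eq g, bohrCoeff_eq, ← mul_assoc, ← expo_add]
  congr 4
  abel

/-- `AP^k_Σ`: the almost periodic functions with Bohr-Fourier spectrum in the additive
semigroup with zero `Σ`. -/
def APOn (Sig : AddSubmonoid (Fin k → ℝ)) : Subalgebra ℂ ((Fin k → ℝ) →ᵇ ℂ) where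
  carrier := {f | f ∈ AP k ∧ bohrSpectrum f ⊆ Sig}
  mul_mem' := by
    rintro f g ⟨hf, hfs⟩ ⟨hg, hgs⟩
    refine ⟨mul_mem hf hg, fun l hl => ?_⟩
    by_contra hlS
    refine hl ((hasSum_bohrCoeff_mul hf hg l).unique ?_)
    convert hasSum_zero with m
    by_contra hne
    have h1 : m ∈ Sig := hfs (left_ne_zero_of_mul hne)
    have h2 : l - m ∈ Sig := hgs (right_ne_zero_of_mul hne)
    exact hlS (by simpa using add_mem h1 h2)
  add_mem' := by
    rintro f g ⟨hf, hfs⟩ ⟨hg, hgs⟩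
    refine ⟨add_mem hf hg, fun l hl => ?_⟩
    by_contra hlS
    refine hl ?_
    rw [bohrCoeff_add hf hg, not_not.1 fun h => hlS (hfs h), not_not.1 fun h => hlS (hgs h),
      add_zero]
  algebraMap_mem' := by
    intro c
    refine ⟨(AP k).algebraMap_mem c, fun l hl => ?_⟩
    by_contra hlS
    refine hl ?_
    have h0 : (0 : Fin k → ℝ) ≠ l := fun h => hlS (h ▸ Sig.zero_mem)
    rw [Algebra.algebraMap_eq_smul_one, ← expo_zero, bohrCoeff_smul c (expo_mem 0),
      bohrCoeff_expo, if_neg h0, mul_zero]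

/-- `APW^k_Σ`: the functions of `AP^k_Σ` with absolutely convergent Bohr-Fourier series. -/
def APWOn (Sig : AddSubmonoid (Fin k → ℝ)) : Subalgebra ℂ ((Fin k → ℝ) →ᵇ ℂ) where
  carrier := {f | f ∈ AP k ∧ (Summable fun l => ‖bohrCoeff f l‖) ∧ bohrSpectrum f ⊆ Sig}
  mul_mem' := by
    rintro f g ⟨hf, hfW, hfs⟩ ⟨hg, hgW, hgs⟩
    refine ⟨mul_mem hf hg, ?_, ((APOn Sig).mul_mem ⟨hf, hfs⟩ ⟨hg, hgs⟩).2⟩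
    have h1 : Summable fun p : (Fin k → ℝ) × (Fin k → ℝ) =>
        ‖bohrCoeff f p.2‖ * ‖bohrCoeff g (p.1 - p.2)‖ := by
      have h := (hgW.mul_of_nonneg hfW (fun _ => norm_nonneg _) (fun _ => norm_nonneg _))
      let sh : (Fin k → ℝ) × (Fin k → ℝ) ≃ (Fin k → ℝ) × (Fin k → ℝ) :=
        { toFun := fun p => (p.1 - p.2, p.2)
          invFun := fun p => (p.1 + p.2, p.2)
          left_inv := fun p => by simp
          right_inv := fun p => by simp }
      exact (sh.summable_iff.2 h).congr fun p => mul_comm _ _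
    refine Summable.of_nonneg_of_le (fun _ => norm_nonneg _) (fun l => ?_) h1.prod
    rw [← (hasSum_bohrCoeff_mul hf hg l).tsum_eq]
    simp_rw [← norm_mul]
    refine norm_tsum_le_tsum_norm ?_
    simpa using h1.prod_factor l
  add_mem' := by
    rintro f g ⟨hf, hfW, hfs⟩ ⟨hg, hgW, hgs⟩
    refine ⟨add_mem hf hg, ?_, ((APOn Sig).add_mem ⟨hf, hfs⟩ ⟨hg, hgs⟩).2⟩
    refine Summable.of_nonneg_of_le (fun _ => norm_nonneg _) (fun l => ?_) (hfW.add hgW)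
    rw [bohrCoeff_add hf hg]
    exact norm_add_le _ _
  algebraMap_mem' := by
    intro c
    obtain ⟨h1, h2⟩ := (APOn Sig).algebraMap_mem c
    refine ⟨h1, summable_of_ne_finset_zero (s := {0}) fun l hl => ?_, h2⟩
    have h0 : (0 : Fin k → ℝ) ≠ l := fun h => hl (by simp [h])
    rw [Algebra.algebraMap_eq_smul_one, ← expo_zero, bohrCoeff_smul c (expo_mem 0),
      bohrCoeff_expo, if_neg h0, mul_zero, norm_zero]

/-- The maximal ideal space of a commutative unital Banach algebra `A`: the nonzero multiplicative
linear functionals, that is, the unital algebra homomorphisms to `ℂ`. They are automatically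
bounded for any norm making `A` a Banach algebra, so that no norm on `A` enters here. -/
def MaximalIdealSpace (A : Type*) [CommRing A] [Algebra ℂ A] : Type _ := A →ₐ[ℂ] ℂ

/-- The weak-* topology: the coarsest one for which all evaluations `φ ↦ φ a` are continuous. -/
instance instTopologicalSpaceMaximalIdealSpace (A : Type*) [CommRing A] [Algebra ℂ A] :
    TopologicalSpace (MaximalIdealSpace A) :=
  TopologicalSpace.induced (fun (φ : A →ₐ[ℂ] ℂ) (a : A) => φ a) inferInstance

end AlmostPeriodic

end

/-!
Both algebras are completions of the monoid algebra `ℂ[Σ]` for norms `‖·‖` with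
`|p_l| ≤ ‖p‖` and `‖e_l‖ ≤ 1`. For any such completion the characters are exactly the
semicharacters of `Σ`, i.e. the homomorphisms `χ` from `Σ` to the closed unit disc: the estimate
`|∑ p_l χ(l)| ≤ #supp(p) ‖p‖`, applied to the powers `p ^ n`, whose supports grow only polynomially
in `n`, becomes `|∑ p_l χ(l)| ≤ ‖p‖`, so that `χ` extends to the completion. Density of `ℂ[Σ]` is
Bochner-Fejér approximation in `AP^k_Σ`, and follows from `APW^k_Σ ≅ ℓ¹(Σ)` in `APW^k_Σ`.

The space of semicharacters is contractible by induction on the dimension. A salient cone containing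
`Σ` admits a nonzero linear functional `f ≥ 0`. Multiplying semicharacters by `t ^ f`, with `t`
running from `1` to `0`, retracts the semicharacters of `Σ` onto those of `Σ ∩ ker f`, extended by
zero.
-/

open Filter Topology MeasureTheory
open scoped BoundedContinuousFunction Pointwise

noncomputable section

namespace AlmostPeriodic

variable {k : ℕ}

/-! ### Polynomial growth in commutative monoids -/

section Growth

variable {M : Type*} [AddCommMonoid M]

lemma card_nsmul_le [DecidableEq M] (s : Finset M) (n : ℕ) : (n • s).card ≤ (n + 1) ^ s.card := by
  have hsub : n • s ⊆ Finset.univ.image fun a : s → Fin (n + 1) => ∑ x, (a x : ℕ) • (x : M) := by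
    intro y hy
    obtain ⟨f, rfl⟩ := Finset.mem_nsmul.1 hy
    let count (x : s) : Fin (n + 1) :=
      ⟨(Finset.univ.filter (f · = x)).card, Nat.lt_succ_of_le (Finset.card_le_univ _ |>.trans_eq
        (Fintype.card_fin n))⟩
    refine Finset.mem_image.2 ⟨count, Finset.mem_univ _, ?_⟩
    rw [List.sum_ofFn, ← Finset.sum_fiberwise' Finset.univ f (fun x => (x : M))]
    simp [count]
  calc (n • s).card ≤ Fintype.card (s → Fin (n + 1)) :=
        (Finset.card_le_card hsub).trans Finset.card_image_le
    _ = (n + 1) ^ s.card := by simp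

lemma le_one_of_pow_le {r : ℝ} {d : ℕ} (h : ∀ n : ℕ, r ^ n ≤ ((n : ℝ) + 1) ^ d) : r ≤ 1 := by
  by_contra! hr
  have hr0 : 0 < r := by linarith
  have hlim : Tendsto (fun n : ℕ => ((n : ℝ) + 1) ^ d / r ^ (n + 1)) atTop (𝓝 0) := by
    refine ((tendsto_pow_const_div_const_pow_of_one_lt d hr).comp
      (tendsto_add_atTop_nat 1)).congr fun n => ?_
    simp
  refine (inv_pos.2 hr0).not_ge (ge_of_tendsto' hlim fun n => ?_)
  rw [le_div_iff₀ (by positivity), pow_succ', inv_mul_cancel_left₀ hr0.ne']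
  exact h n

lemma exists_card_succ_nsmul_le [DecidableEq M] (s : Finset M) {δ : ℝ} (hδ : 0 < δ) :
    ∃ n : ℕ, (((n + 1) • s).card : ℝ) ≤ (1 + δ) * (n • s).card := by
  by_contra! hlarge
  have hpow (n : ℕ) : (1 + δ) ^ n ≤ ((n • s).card : ℝ) := by
    induction n with
    | zero => simp
    | succ n ih =>
      rw [pow_succ']
      exact (mul_le_mul_of_nonneg_left ih (by linarith)).trans (hlarge n).le
  have : 1 + δ ≤ 1 := le_one_of_pow_le (d := s.card) fun n =>
    (hpow n).trans (by exact_mod_cast card_nsmul_le s n)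
  linarith

lemma exists_almost_invariant_finset {G : Type*} [AddCommGroup G] [DecidableEq G] (s : Finset G)
    {δ : ℝ} (hδ : 0 < δ) :
    ∃ B : Finset G, B.Nonempty ∧ ∀ m ∈ s, (1 - δ) * B.card ≤ ((B ∩ (m +ᵥ B)).card : ℝ) := by
  set t := insert 0 s
  obtain ⟨n, hn⟩ := exists_card_succ_nsmul_le t hδ
  have hzero : (0 : G) ∈ t := Finset.mem_insert_self 0 s
  refine ⟨n • t, (Finset.insert_nonempty 0 s).nsmul, fun m hm => ?_⟩
  have hunion : n • t ∪ (m +ᵥ n • t) ⊆ (n + 1) • t := by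
    refine Finset.union_subset (Finset.nsmul_subset_nsmul_right hzero n.le_succ) ?_
    rw [succ_nsmul']
    exact Finset.vadd_finset_subset_add (Finset.mem_insert_of_mem hm)
  have hcard : ((n • t ∪ (m +ᵥ n • t)).card : ℝ) + (n • t ∩ (m +ᵥ n • t)).card
      = (n • t).card + (n • t).card := by
    exact_mod_cast (Finset.card_union_add_card_inter _ _).trans (by rw [Finset.card_vadd_finset])
  have hle : ((n • t ∪ (m +ᵥ n • t)).card : ℝ) ≤ ((n + 1) • t).card := by
    exact_mod_cast Finset.card_le_card hunion
  linarith

lemma support_coeff_pow_subset [DecidableEq M] {R : Type*} [Semiring R]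
    (p : AddMonoidAlgebra R M) (n : ℕ) : (p ^ n).coeff.support ⊆ n • p.coeff.support := by
  induction n with
  | zero => simpa using AddMonoidAlgebra.support_coeff_one_subset
  | succ n ih =>
    rw [pow_succ, succ_nsmul]
    exact (AddMonoidAlgebra.support_coeff_mul_subset _ _).trans (Finset.add_subset_add_right ih)

lemma card_support_coeff_pow_le {R : Type*} [Semiring R] (p : AddMonoidAlgebra R M) (n : ℕ) :
    (p ^ n).coeff.support.card ≤ (n + 1) ^ p.coeff.support.card := by
  classical
  exact (Finset.card_le_card (support_coeff_pow_subset p n)).trans (card_nsmul_le _ n)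

end Growth

/-! ### Semicharacters -/

/-- The semicharacters of an additive monoid `M`: the homomorphisms from `M` to the multiplicative
monoid of the closed unit disc. -/
abbrev Semichar (M : Type*) [AddMonoid M] : Type _ := AddChar M (Metric.closedBall (0 : ℂ) 1)

namespace Semichar

section Topology

variable {M X : Type*} [AddMonoid M] [TopologicalSpace X]

/-- The topology of pointwise convergence. -/
instance : TopologicalSpace (Semichar M) := TopologicalSpace.induced (fun χ l => χ l) inferInstance

lemma continuous_eval (l : M) : Continuous fun χ : Semichar M => χ l :=
  (continuous_apply l).comp continuous_induced_dom

lemma continuous_of_continuous_eval {F : X → Semichar M} (hF : ∀ l, Continuous fun x => F x l) :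
    Continuous F :=
  continuous_induced_rng.2 (continuous_pi hF)

end Topology

section Retraction

variable {M : Type*} [AddCommMonoid M] (f : M →+ NNReal)

/-- The semicharacter `l ↦ t ^ f l`. At `t = 0` it is the indicator function of the kernel of `f`,
because of the convention `0 ^ 0 = 1`. -/
def damping (t : unitInterval) : Semichar M where
  toFun l := ⟨(((t : ℝ) ^ (f l : ℝ) : ℝ) : ℂ), by
    rw [mem_closedBall_zero_iff, Complex.norm_real,
      Real.norm_of_nonneg (Real.rpow_nonneg t.2.1 _)]
    exact Real.rpow_le_one t.2.1 t.2.2 (f l).coe_nonneg⟩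
  map_zero_eq_one' := Subtype.ext (by simp)
  map_add_eq_mul' l m := Subtype.ext (by
    have h : (t : ℝ) ^ (f (l + m) : ℝ) = (t : ℝ) ^ (f l : ℝ) * (t : ℝ) ^ (f m : ℝ) := by
      rw [map_add, NNReal.coe_add, Real.rpow_add_of_nonneg t.2.1 (f l).coe_nonneg (f m).coe_nonneg]
    exact (congrArg Complex.ofReal h).trans (Complex.ofReal_mul _ _))

lemma coe_damping_apply (t : unitInterval) (l : M) :
    (damping f t l : ℂ) = (((t : ℝ) ^ (f l : ℝ) : ℝ) : ℂ) := rfl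

lemma damping_one : damping f 1 = 1 := by
  ext l
  simp [coe_damping_apply]

lemma damping_zero_apply_of_eq_zero {l : M} (hl : f l = 0) : damping f 0 l = 1 :=
  Subtype.ext (by simp [coe_damping_apply, hl])

lemma damping_zero_apply_of_ne_zero {l : M} (hl : f l ≠ 0) : damping f 0 l = 0 :=
  Subtype.ext (by simp [coe_damping_apply, hl])

lemma continuous_damping_apply (l : M) : Continuous fun t => damping f t l :=
  (Complex.continuous_ofReal.comp
    (continuous_subtype_val.rpow_const fun _ => Or.inr (f l).coe_nonneg)).subtype_mk _

open Classical in
/-- Extends a semicharacter of the kernel of `f` by zero. -/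
def extendByZero (χ : Semichar (AddMonoidHom.mker f)) : Semichar M where
  toFun l := if hl : f l = 0 then χ ⟨l, hl⟩ else 0
  map_zero_eq_one' := by
    rw [dif_pos (map_zero f)]
    exact χ.map_zero_eq_one
  map_add_eq_mul' l m := by
    by_cases hl : f l = 0
    · by_cases hm : f m = 0
      · rw [dif_pos hl, dif_pos hm, dif_pos (by rw [map_add, hl, hm, add_zero]),
          ← χ.map_add_eq_mul]
        rfl
      · rw [dif_neg hm, mul_zero, dif_neg fun h => hm (add_eq_zero.1 (map_add f l m ▸ h)).2]
    · rw [dif_neg hl, zero_mul, dif_neg fun h => hl (add_eq_zero.1 (map_add f l m ▸ h)).1]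

lemma extendByZero_apply_of_eq_zero (χ : Semichar (AddMonoidHom.mker f)) {l : M} (hl : f l = 0) :
    extendByZero f χ l = χ ⟨l, hl⟩ := dif_pos hl

lemma extendByZero_apply_of_ne_zero (χ : Semichar (AddMonoidHom.mker f)) {l : M} (hl : f l ≠ 0) :
    extendByZero f χ l = 0 := dif_neg hl

lemma continuous_extendByZero : Continuous (extendByZero f) := by
  refine continuous_of_continuous_eval fun l => ?_
  by_cases hl : f l = 0
  · simpa only [extendByZero_apply_of_eq_zero f _ hl] using continuous_eval _
  · simpa only [extendByZero_apply_of_ne_zero f _ hl] using continuous_const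

lemma extendByZero_comp_subtype (χ : Semichar M) :
    extendByZero f (χ.compAddMonoidHom (AddMonoidHom.mker f).subtype) = damping f 0 * χ := by
  refine DFunLike.ext _ _ fun l => ?_
  by_cases hl : f l = 0
  · rw [extendByZero_apply_of_eq_zero f _ hl, AddChar.mul_apply,
      damping_zero_apply_of_eq_zero f hl, one_mul]
    rfl
  · rw [extendByZero_apply_of_ne_zero f _ hl, AddChar.mul_apply,
      damping_zero_apply_of_ne_zero f hl, zero_mul]

/-- Letting the damping parameter run from `0` to `1` deforms the extension by zero of the
restriction of a semicharacter back into that semicharacter. -/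
def homotopyEquivKernel :
    ContinuousMap.HomotopyEquiv (Semichar M) (Semichar (AddMonoidHom.mker f)) where
  toFun := ⟨fun χ => χ.compAddMonoidHom (AddMonoidHom.mker f).subtype,
    continuous_of_continuous_eval fun l => continuous_eval (l : M)⟩
  invFun := ⟨extendByZero f, continuous_extendByZero f⟩
  left_inv := ⟨{
    toFun := fun p => damping f p.1 * p.2
    continuous_toFun := continuous_of_continuous_eval fun l =>
      ((continuous_damping_apply f l).comp continuous_fst).mul
        ((continuous_eval l).comp continuous_snd)
    map_zero_left := fun χ => (extendByZero_comp_subtype f χ).symm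
    map_one_left := fun χ => by
      rw [damping_one]
      exact one_mul χ }⟩
  right_inv := by
    have : ∀ χ, (extendByZero f χ).compAddMonoidHom (AddMonoidHom.mker f).subtype = χ :=
      fun χ => DFunLike.ext _ _ fun l => extendByZero_apply_of_eq_zero f χ l.2
    rw [show ContinuousMap.comp _ _ = ContinuousMap.id _ from ContinuousMap.ext this]

end Retraction

end Semichar

/-! ### Salient cones -/

section Salient

variable {V : Type*} [NormedAddCommGroup V] [NormedSpace ℝ V]

lemma zero_notMem_interior_of_salient [Nontrivial V] {C : PointedCone ℝ V}
    (hC : C.toConvexCone.Salient) : (0 : V) ∉ interior (C : Set V) := by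
  intro h
  have hmem : (C : Set V) ∈ 𝓝 0 := mem_interior_iff_mem_nhds.1 h
  have hneg : {x : V | -x ∈ C} ∈ 𝓝 0 := continuous_neg.continuousAt.preimage_mem_nhds (by simpa)
  have := Module.punctured_nhds_neBot ℝ V (0 : V)
  obtain ⟨x, ⟨hx, hnegx⟩, hx0⟩ :=
    nonempty_of_mem (inter_mem (mem_nhdsWithin_of_mem_nhds (inter_mem hmem hneg))
      (self_mem_nhdsWithin (a := (0 : V)) (s := {0}ᶜ)))
  exact hC x hx hx0 hnegx

lemma exists_nonneg_functional_of_salient [FiniteDimensional ℝ V] [Nontrivial V]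
    {C : PointedCone ℝ V} (hC : C.toConvexCone.Salient) :
    ∃ f : V →ₗ[ℝ] ℝ, f ≠ 0 ∧ ∀ x ∈ C, 0 ≤ f x := by
  by_cases hspan : Submodule.span ℝ (C : Set V) = ⊤
  · have haff : affineSpan ℝ (C : Set V) = ⊤ := by
      refine SetLike.coe_injective ?_
      rw [← Set.insert_eq_of_mem (SetLike.mem_coe.2 C.zero_mem), affineSpan_insert_zero, hspan]
      rfl
    obtain ⟨f, hf0, hf⟩ := geometric_hahn_banach_of_nonempty_interior_point C.convex
      (zero_notMem_interior_of_salient hC)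
      (C.convex.interior_nonempty_iff_affineSpan_eq_top.2 haff)
    refine ⟨-(f : V →ₗ[ℝ] ℝ), neg_ne_zero.2 fun h => hf0 ?_, fun x hx => ?_⟩
    · exact ContinuousLinearMap.coe_injective h
    · simpa using hf x hx
  · obtain ⟨f, hf0, hf⟩ := Submodule.exists_le_ker_of_lt_top _ (lt_top_iff_ne_top.2 hspan)
    exact ⟨f, hf0, fun x hx => (hf (Submodule.subset_span hx)).ge⟩

theorem Semichar.contractibleSpace_of_salient {n : ℕ} [FiniteDimensional ℝ V]
    (hn : Module.finrank ℝ V = n) {M : Type*} [AddCommMonoid M] (ι : M →+ V)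
    (hι : ∀ l, ι l = 0 → l = 0) {C : PointedCone ℝ V} (hC : C.toConvexCone.Salient)
    (hιC : ∀ l, ι l ∈ C) : ContractibleSpace (Semichar M) := by
  induction n using Nat.strong_induction_on generalizing V M with
  | _ n ih =>
  rcases subsingleton_or_nontrivial V with hV | hV
  · have hM : ∀ l : M, l = 0 := fun l => hι l (Subsingleton.elim _ _)
    have : Unique (Semichar M) :=
      { default := 1, uniq := fun χ => DFunLike.ext _ _ fun l => by
          rw [hM l, AddChar.map_zero_eq_one, AddChar.map_zero_eq_one] }
    exact (Homeomorph.homeomorphOfUnique (Semichar M) Unit).contractibleSpace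
  · obtain ⟨f, hf0, hf⟩ := exists_nonneg_functional_of_salient hC
    let g : M →+ NNReal :=
      { toFun := fun l => (f (ι l)).toNNReal
        map_zero' := by simp
        map_add' := fun l m => by
          rw [map_add, map_add, Real.toNNReal_add (hf _ (hιC l)) (hf _ (hιC m))] }
    have hker (l : AddMonoidHom.mker g) : ι l ∈ LinearMap.ker f :=
      (Real.toNNReal_eq_zero.1 l.2).antisymm (hf _ (hιC l))
    let κ : AddMonoidHom.mker g →+ LinearMap.ker f :=
      (ι.comp (AddMonoidHom.mker g).subtype).codRestrict (LinearMap.ker f) hker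
    have hlt : Module.finrank ℝ (LinearMap.ker f) < n :=
      hn ▸ Submodule.finrank_lt (by rwa [Ne, LinearMap.ker_eq_top])
    have := ih _ hlt rfl κ (fun l hl => Subtype.ext (hι l (congrArg Subtype.val hl)))
      (C := C.comap (LinearMap.ker f).subtype)
      (fun x hx hx0 => hC x hx (by simpa using hx0)) (fun l => hιC l)
    exact (Semichar.homotopyEquivKernel g).contractibleSpace

end Salient

/-- The halfspace `S` as a pointed convex cone. -/
def IsHalfspace.toPointedCone {S : Set (Fin k → ℝ)} (hS : IsHalfspace S) :
    PointedCone ℝ (Fin k → ℝ) where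
  carrier := S
  add_mem' ha hb := hS.add_mem _ ha _ hb
  zero_mem' := (hS.inter_neg.ge rfl).1
  smul_mem' c _ hx := hS.smul_mem _ hx c c.2

lemma IsHalfspace.salient {S : Set (Fin k → ℝ)} (hS : IsHalfspace S) :
    hS.toPointedCone.toConvexCone.Salient :=
  fun _ hx hx0 hneg => hx0 (hS.inter_neg.le ⟨hx, hneg⟩)

/-! ### Banach algebra completions of monoid algebras -/

section MonoidAlgebra

variable {M : Type*} [AddCommMonoid M]

/-- The value `∑ p_l χ(l)` of the polynomial `p = ∑ p_l l` at the semicharacter `χ`. -/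
def Semichar.eval (χ : Semichar M) : AddMonoidAlgebra ℂ M →ₐ[ℂ] ℂ :=
  AddMonoidAlgebra.lift ℂ ℂ M ((Submonoid.unitClosedBall ℂ).subtype.comp χ.toMonoidHom)

lemma Semichar.eval_apply (χ : Semichar M) (p : AddMonoidAlgebra ℂ M) :
    χ.eval p = ∑ l ∈ p.coeff.support, p.coeff l * χ l :=
  AddMonoidAlgebra.lift_apply _ _

lemma Semichar.eval_of (χ : Semichar M) (l : M) :
    χ.eval (AddMonoidAlgebra.of ℂ M (.ofAdd l)) = χ l :=
  AddMonoidAlgebra.lift_of _ _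

lemma Semichar.continuous_eval_apply (p : AddMonoidAlgebra ℂ M) :
    Continuous fun χ : Semichar M => χ.eval p := by
  simp only [Semichar.eval_apply]
  exact continuous_finsetSum _ fun l _ =>
    continuous_const.mul (continuous_subtype_val.comp (Semichar.continuous_eval l))

lemma continuous_eval_character {A : Type*} [CommRing A] [Algebra ℂ A] (a : A) :
    Continuous fun φ : MaximalIdealSpace A => (show A →ₐ[ℂ] ℂ from φ) a :=
  (continuous_apply a).comp
    (continuous_induced_dom (f := fun (φ : A →ₐ[ℂ] ℂ) (a : A) => φ a))

variable {A : Type*} [NormedCommRing A] [NormedAlgebra ℂ A]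

/-- `T` exhibits the Banach algebra `A` as the completion of the monoid algebra of `M` for a norm
which is at most one on `M` and dominates the coefficients. -/
structure IsMonoidAlgebraCompletion (T : AddMonoidAlgebra ℂ M →ₐ[ℂ] A) : Prop where
  denseRange : DenseRange T
  norm_of_le : ∀ l : Multiplicative M, ‖T (AddMonoidAlgebra.of ℂ M l)‖ ≤ 1
  norm_coeff_le : ∀ p l, ‖p.coeff l‖ ≤ ‖T p‖

namespace IsMonoidAlgebraCompletion

variable {T : AddMonoidAlgebra ℂ M →ₐ[ℂ] A} (hT : IsMonoidAlgebraCompletion T)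
include hT

lemma normOneClass : NormOneClass A where
  norm_one := by
    refine le_antisymm ?_ ?_
    · simpa only [map_one] using hT.norm_of_le 1
    · simpa only [map_one, AddMonoidAlgebra.coeff_one_zero, norm_one] using hT.norm_coeff_le 1 0

lemma norm_apply_le [CompleteSpace A] (φ : A →ₐ[ℂ] ℂ) (a : A) : ‖φ a‖ ≤ ‖a‖ :=
  have := hT.normOneClass
  AlgHom.norm_apply_le_self φ a

lemma norm_eval_le_card_mul (χ : Semichar M) (p : AddMonoidAlgebra ℂ M) :
    ‖χ.eval p‖ ≤ p.coeff.support.card * ‖T p‖ := by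
  rw [Semichar.eval_apply, ← nsmul_eq_mul]
  refine (norm_sum_le _ _).trans (Finset.sum_le_card_nsmul _ _ _ fun l _ => ?_)
  rw [norm_mul]
  exact (mul_le_of_le_one_right (norm_nonneg _) (mem_closedBall_zero_iff.1 (χ l).2)).trans
    (hT.norm_coeff_le p l)

/- The trivial bound applied to `p ^ n` is only lossy by the cardinality of the support of `p ^ n`,
which grows polynomially in `n`, so that taking `n`-th roots removes the loss. -/
lemma norm_eval_le (χ : Semichar M) (p : AddMonoidAlgebra ℂ M) : ‖χ.eval p‖ ≤ ‖T p‖ := by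
  have := hT.normOneClass
  have hpow (n : ℕ) : ‖χ.eval p‖ ^ n ≤ ((n : ℝ) + 1) ^ p.coeff.support.card * ‖T p‖ ^ n :=
    calc ‖χ.eval p‖ ^ n = ‖χ.eval (p ^ n)‖ := by rw [map_pow, norm_pow]
      _ ≤ (p ^ n).coeff.support.card * ‖T (p ^ n)‖ := hT.norm_eval_le_card_mul χ (p ^ n)
      _ ≤ ((n : ℝ) + 1) ^ p.coeff.support.card * ‖T p‖ ^ n := by
        rw [map_pow]
        gcongr
        · exact_mod_cast card_support_coeff_pow_le p n
        · exact norm_pow_le _ n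
  rcases (norm_nonneg (T p)).eq_or_lt with h0 | h0
  · simpa [← h0] using hpow 1
  · rw [← div_le_one h0]
    refine le_one_of_pow_le (d := p.coeff.support.card) fun n => ?_
    rw [div_pow, div_le_iff₀ (by positivity)]
    exact hpow n

lemma exists_extension (χ : Semichar M) : ∃ φ : A →ₐ[ℂ] ℂ, ∀ p, φ (T p) = χ.eval p := by
  let ψ : A →L[ℂ] ℂ := χ.eval.toLinearMap.extendOfNorm T.toLinearMap
  have hψ : ∀ p, ψ (T p) = χ.eval p :=
    LinearMap.extendOfNorm_eq (e := T.toLinearMap) hT.denseRange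
      ⟨1, fun p => by rw [one_mul]; exact hT.norm_eval_le χ p⟩
  refine ⟨AlgHom.ofLinearMap ψ ?_ ?_, hψ⟩
  · change ψ 1 = 1
    rw [← map_one T, hψ, map_one]
  · refine hT.denseRange.induction_on₂ ?_ fun p q => ?_
    · exact isClosed_eq (ψ.continuous.comp continuous_mul)
        ((ψ.continuous.comp continuous_fst).mul (ψ.continuous.comp continuous_snd))
    · change ψ _ = ψ _ * ψ _
      rw [← map_mul, hψ, hψ, hψ, map_mul]

/-- The character of the completion extending a semicharacter. -/
def extension (χ : Semichar M) : A →ₐ[ℂ] ℂ := (hT.exists_extension χ).choose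

lemma extension_apply (χ : Semichar M) (p : AddMonoidAlgebra ℂ M) :
    hT.extension χ (T p) = χ.eval p := (hT.exists_extension χ).choose_spec p

lemma continuous_extension [CompleteSpace A] :
    Continuous (Y := MaximalIdealSpace A) hT.extension := by
  refine continuous_induced_rng.2 (continuous_pi fun a => ?_)
  refine continuous_of_uniform_approx_of_continuous fun u hu => ?_
  obtain ⟨ε, hε, hεu⟩ := Metric.mem_uniformity_dist.1 hu
  obtain ⟨p, hp⟩ := hT.denseRange.exists_dist_lt a hε
  refine ⟨fun χ => χ.eval p, Semichar.continuous_eval_apply p, fun χ => hεu ?_⟩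
  rw [dist_eq_norm] at hp
  change dist (hT.extension χ a) (χ.eval p) < ε
  rw [← hT.extension_apply, dist_eq_norm, ← map_sub]
  exact (hT.norm_apply_le _ _).trans_lt hp

/-- The semicharacter obtained by restricting a character of the completion to `M`. -/
def restriction [CompleteSpace A] (φ : A →ₐ[ℂ] ℂ) : Semichar M where
  toFun l := ⟨φ (T (AddMonoidAlgebra.of ℂ M (.ofAdd l))), mem_closedBall_zero_iff.2 <|
    (hT.norm_apply_le φ _).trans (hT.norm_of_le _)⟩
  map_zero_eq_one' := Subtype.ext (by simp only [ofAdd_zero, map_one]; rfl)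
  map_add_eq_mul' l m := Subtype.ext (by simp only [ofAdd_add, map_mul]; rfl)

lemma eval_restriction [CompleteSpace A] (φ : A →ₐ[ℂ] ℂ) :
    (hT.restriction φ).eval = φ.comp T := by
  refine AddMonoidAlgebra.algHom_ext (fun l => ?_) (Subsingleton.elim _ _)
  exact Semichar.eval_of (hT.restriction φ) l

lemma continuous_restriction [CompleteSpace A] :
    Continuous (X := MaximalIdealSpace A) hT.restriction :=
  Semichar.continuous_of_continuous_eval fun _ => (continuous_eval_character _).subtype_mk _

lemma extension_restriction [CompleteSpace A] (φ : A →ₐ[ℂ] ℂ) :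
    hT.extension (hT.restriction φ) = φ := by
  have heq : hT.extension (hT.restriction φ) ∘ T = φ ∘ T := funext fun p => by
    rw [Function.comp_apply, hT.extension_apply, hT.eval_restriction]
    rfl
  have hcont (ψ : A →ₐ[ℂ] ℂ) : Continuous ψ :=
    AddMonoidHomClass.continuous_of_bound ψ 1 fun a => by
      rw [one_mul]
      exact hT.norm_apply_le ψ a
  exact DFunLike.coe_injective (hT.denseRange.equalizer (hcont _) (hcont _) heq)

lemma restriction_extension [CompleteSpace A] (χ : Semichar M) :
    hT.restriction (hT.extension χ) = χ :=
  DFunLike.ext _ _ fun l => Subtype.ext ((hT.extension_apply χ _).trans (χ.eval_of l))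

/-- The character space of the completion is the space of semicharacters. -/
def homeomorphSemichar [CompleteSpace A] : MaximalIdealSpace A ≃ₜ Semichar M where
  toFun := hT.restriction
  invFun := hT.extension
  left_inv := hT.extension_restriction
  right_inv := hT.restriction_extension
  continuous_toFun := hT.continuous_restriction
  continuous_invFun := hT.continuous_extension

end IsMonoidAlgebraCompletion

end MonoidAlgebra

/-! ### Bochner-Fejér summation -/

section BochnerFejer

lemma norm_expo (l : Fin k → ℝ) : ‖expo l‖ = 1 := by
  refine le_antisymm (BoundedContinuousFunction.norm_ofNormedAddCommGroup_le _ zero_le_one _) ?_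
  simpa [expo_apply] using (expo l).norm_coe_le_norm 0

lemma norm_bohrCoeff_le {f : (Fin k → ℝ) →ᵇ ℂ} (hf : f ∈ AP k) (l : Fin k → ℝ) :
    ‖bohrCoeff f l‖ ≤ ‖f‖ :=
  calc ‖bohrCoeff f l‖ = ‖bohrMean (expo (-l) * f : (Fin k → ℝ) →ᵇ ℂ)‖ := by rw [bohrCoeff_eq]
    _ ≤ ‖expo (-l) * f‖ := norm_bohrMean_le (mul_mem (expo_mem _) hf)
    _ ≤ ‖expo (-l)‖ * ‖f‖ := norm_mul_le _ _
    _ = ‖f‖ := by rw [norm_expo, one_mul]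

/-- The Bohr-Fourier coefficient at `l` as a continuous linear functional. -/
def bohrCoeffCLM (l : Fin k → ℝ) : AP k →L[ℂ] ℂ :=
  LinearMap.mkContinuous
    { toFun := fun f => bohrCoeff (f : (Fin k → ℝ) →ᵇ ℂ) l
      map_add' := fun f g => bohrCoeff_add f.2 g.2 l
      map_smul' := fun c f => bohrCoeff_smul c f.2 l }
    1 fun f => (norm_bohrCoeff_le f.2 l).trans_eq (one_mul _).symm

lemma bohrCoeffCLM_apply (l : Fin k → ℝ) (f : AP k) :
    bohrCoeffCLM l f = bohrCoeff (f : (Fin k → ℝ) →ᵇ ℂ) l := rfl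

lemma norm_bohrMean_mul_le_of_nonneg {f h : (Fin k → ℝ) →ᵇ ℂ} (hf : f ∈ AP k) (hh : h ∈ AP k)
    (hnonneg : ∀ x, h x = ‖h x‖) :
    ‖bohrMean (f * h : (Fin k → ℝ) →ᵇ ℂ)‖ ≤ ‖f‖ * (bohrMean h).re := by
  refine le_of_tendsto_of_tendsto (tendsto_cubeAvg (mul_mem hf hh)).norm
    (((Complex.continuous_re.tendsto _).comp (tendsto_cubeAvg hh)).const_mul _) ?_
  filter_upwards [eventually_gt_atTop 0] with T hT
  let Q := Set.Icc (fun _ : Fin k => -T) (fun _ : Fin k => T)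
  have hre : (cubeAvg h T).re = 1 / (2 * T) ^ k * ∫ x in Q, ‖h x‖ := by
    rw [cubeAvg, Complex.re_ofReal_mul, ← Complex.ofReal_re (∫ x in Q, ‖h x‖),
      ← integral_complex_ofReal]
    simp_rw [← hnonneg]
    rfl
  have hpt : ‖∫ x in Q, (f * h : (Fin k → ℝ) →ᵇ ℂ) x‖ ≤ ‖f‖ * ∫ x in Q, ‖h x‖ := by
    rw [← integral_const_mul]
    refine norm_integral_le_of_norm_le ((integrableOn_cube h T).norm.const_mul _)
      (Eventually.of_forall fun x => ?_)
    rw [BoundedContinuousFunction.coe_mul, Pi.mul_apply, norm_mul]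
    gcongr
    exact f.norm_coe_le_norm x
  rw [Function.comp_apply, hre, cubeAvg, norm_mul, Complex.norm_real,
    Real.norm_of_nonneg (by positivity), mul_left_comm]
  gcongr

/-- The Bochner-Fejér polynomial of `f` attached to a finite set `B` of frequencies: the average
over `b ∈ B` of the sections of the Fourier series of `f` to the translates `B - b`. -/
def fejer (B : Finset (Fin k → ℝ)) : AP k →ₗ[ℂ] (Fin k → ℝ) →ᵇ ℂ :=
  (B.card : ℂ)⁻¹ •
    ∑ a ∈ B, ∑ b ∈ B, (bohrCoeffCLM (a - b) : AP k →ₗ[ℂ] ℂ).smulRight (expo (a - b))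

lemma fejer_apply (B : Finset (Fin k → ℝ)) (f : AP k) :
    fejer B f = (B.card : ℂ)⁻¹ • ∑ a ∈ B, ∑ b ∈ B,
      bohrCoeff (f : (Fin k → ℝ) →ᵇ ℂ) (a - b) • expo (a - b) := by
  simp only [fejer, LinearMap.smul_apply, LinearMap.sum_apply, LinearMap.smulRight_apply]
  rfl

open Classical in
lemma fejer_expo (B : Finset (Fin k → ℝ)) (m : Fin k → ℝ) :
    fejer B ⟨expo m, expo_mem m⟩ =
      (((B ∩ (m +ᵥ B)).card / B.card : ℝ) : ℂ) • expo m := by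
  have hinner : ∀ a ∈ B, ∑ b ∈ B, bohrCoeff (expo m) (a - b) • expo (a - b) =
      if a ∈ m +ᵥ B then expo m else 0 := fun a _ => by
    have hiff (b : Fin k → ℝ) : m = a - b ↔ a - m = b := by
      rw [eq_sub_iff_add_eq', sub_eq_iff_eq_add, eq_comm]
    simp only [bohrCoeff_expo, hiff, ite_smul, one_smul, zero_smul, Finset.sum_ite_eq,
      sub_sub_cancel, ← Finset.neg_vadd_mem_iff, vadd_eq_add, neg_add_eq_sub]
  rw [fejer_apply, Finset.sum_congr rfl hinner, Finset.sum_ite_mem, Finset.sum_const,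
    ← Nat.cast_smul_eq_nsmul ℂ, smul_smul]
  push_cast
  rw [inv_mul_eq_div]

/-- The Bochner-Fejér kernel `y ↦ K(x - y)`: convolution with `K` is `fejer B`. -/
def fejerKernel (B : Finset (Fin k → ℝ)) (x : Fin k → ℝ) : (Fin k → ℝ) →ᵇ ℂ :=
  (B.card : ℂ)⁻¹ • ∑ a ∈ B, ∑ b ∈ B, expo (a - b) x • expo (-(a - b))

lemma fejerKernel_mem (B : Finset (Fin k → ℝ)) (x : Fin k → ℝ) : fejerKernel B x ∈ AP k :=
  (AP k).smul_mem (sum_mem fun _ _ => sum_mem fun _ _ => (AP k).smul_mem (expo_mem _) _) _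

lemma fejerKernel_apply (B : Finset (Fin k → ℝ)) (x y : Fin k → ℝ) :
    fejerKernel B x y = (((B.card : ℝ)⁻¹ * ‖∑ a ∈ B, expo a (x - y)‖ ^ 2 : ℝ) : ℂ) := by
  have hterm (a b : Fin k → ℝ) : expo (a - b) x * expo (-(a - b)) y =
      expo a (x - y) * star (expo b (x - y)) := by
    rw [← BoundedContinuousFunction.star_apply, star_expo]
    simp only [expo_apply, ← Complex.exp_add]
    congr 1
    simp only [neg_dotProduct, sub_dotProduct, dotProduct_sub]
    push_cast
    ring
  simp only [fejerKernel, BoundedContinuousFunction.coe_smul, BoundedContinuousFunction.coe_sum,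
    Finset.sum_apply, smul_eq_mul, hterm]
  rw [← Finset.sum_mul_sum, ← star_sum, RCLike.star_def, Complex.mul_conj']
  push_cast
  rfl

lemma bohrMean_mul_fejerKernel (B : Finset (Fin k → ℝ)) (x : Fin k → ℝ) (f : AP k) :
    bohrMean (f * fejerKernel B x : (Fin k → ℝ) →ᵇ ℂ) = fejer B f x := by
  have hmem (a b : Fin k → ℝ) :
      (f * expo (a - b) x • expo (-(a - b)) : (Fin k → ℝ) →ᵇ ℂ) ∈ AP k :=
    mul_mem f.2 ((AP k).smul_mem (expo_mem _) _)
  have hterm (a b : Fin k → ℝ) :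
      bohrMean (f * expo (a - b) x • expo (-(a - b)) : (Fin k → ℝ) →ᵇ ℂ) =
        bohrCoeff (f : (Fin k → ℝ) →ᵇ ℂ) (a - b) * expo (a - b) x := by
    rw [mul_smul_comm, bohrMean_smul _ (mul_mem f.2 (expo_mem _)), mul_comm f.1, ← bohrCoeff_eq,
      mul_comm]
  rw [fejerKernel, mul_smul_comm, Finset.mul_sum]
  simp_rw [Finset.mul_sum]
  rw [bohrMean_smul _ (sum_mem fun a _ => sum_mem fun b _ => hmem a b),
    bohrMean_sum _ _ fun a => sum_mem fun b _ => hmem a b]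
  have hsum (a : Fin k → ℝ) := bohrMean_sum B _ fun b => hmem a b
  simp only [hsum, hterm]
  simp only [fejer_apply, BoundedContinuousFunction.coe_smul,
    BoundedContinuousFunction.coe_sum, Finset.sum_apply, smul_eq_mul]

lemma norm_fejer_le {B : Finset (Fin k → ℝ)} (hB : B.Nonempty) (f : AP k) :
    ‖fejer B f‖ ≤ ‖f‖ := by
  classical
  refine (BoundedContinuousFunction.norm_le (norm_nonneg f)).2 fun x => ?_
  have hmean : bohrMean (fejerKernel B x) = 1 := by
    have h := bohrMean_mul_fejerKernel B x ⟨expo 0, expo_mem 0⟩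
    rw [fejer_expo, zero_vadd, Finset.inter_self,
      div_self (Nat.cast_ne_zero.2 hB.card_ne_zero)] at h
    simpa [expo_zero] using h
  have h := norm_bohrMean_mul_le_of_nonneg f.2 (fejerKernel_mem B x) fun y => by
    rw [fejerKernel_apply, Complex.norm_real, Real.norm_of_nonneg (by positivity)]
  rwa [bohrMean_mul_fejerKernel, hmean, Complex.one_re, mul_one] at h

lemma exists_forall_norm_expo_sub_fejer_le (s : Finset (Fin k → ℝ)) {δ : ℝ} (hδ : 0 < δ) :
    ∃ B : Finset (Fin k → ℝ), B.Nonempty ∧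
      ∀ m ∈ s, ‖expo m - fejer B ⟨expo m, expo_mem m⟩‖ ≤ δ := by
  classical
  obtain ⟨B, hB, hBs⟩ := exists_almost_invariant_finset s hδ
  have hcard : (0 : ℝ) < B.card := by exact_mod_cast hB.card_pos
  refine ⟨B, hB, fun m hm => ?_⟩
  have hle : ((B ∩ (m +ᵥ B)).card / B.card : ℝ) ≤ 1 :=
    div_le_one_of_le₀ (by exact_mod_cast Finset.card_le_card Finset.inter_subset_left) hcard.le
  have hge : 1 - δ ≤ ((B ∩ (m +ᵥ B)).card / B.card : ℝ) :=
    (le_div_iff₀ hcard).2 (hBs m hm)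
  have heq (c : ℝ) : expo m - (c : ℂ) • expo m = ((1 - c : ℝ) : ℂ) • expo m := by
    push_cast
    rw [sub_smul, one_smul]
  rw [fejer_expo, heq, norm_smul, norm_expo, mul_one, Complex.norm_real,
    Real.norm_of_nonneg (sub_nonneg.2 hle)]
  linarith

lemma exists_norm_sub_fejer_le_of_mem_span {f : AP k}
    (hf : (f : (Fin k → ℝ) →ᵇ ℂ) ∈ Submodule.span ℂ (Set.range expo)) {ε : ℝ} (hε : 0 < ε) :
    ∃ B : Finset (Fin k → ℝ), B.Nonempty ∧ ‖(f : (Fin k → ℝ) →ᵇ ℂ) - fejer B f‖ ≤ ε := by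
  obtain ⟨c, hc⟩ := Finsupp.mem_span_range_iff_exists_finsupp.1 hf
  have hfc : f = ∑ m ∈ c.support, c m • ⟨expo m, expo_mem m⟩ :=
    Subtype.ext <| by rw [← hc, AddSubmonoidClass.coe_finsetSum]; rfl
  set C := ∑ m ∈ c.support, ‖c m‖ with hC
  have hC0 : 0 ≤ C := Finset.sum_nonneg fun _ _ => norm_nonneg _
  obtain ⟨B, hB, hBm⟩ := exists_forall_norm_expo_sub_fejer_le c.support
    (δ := ε / (C + 1)) (by positivity)
  refine ⟨B, hB, ?_⟩
  calc ‖(f : (Fin k → ℝ) →ᵇ ℂ) - fejer B f‖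
      = ‖∑ m ∈ c.support, c m • (expo m - fejer B ⟨expo m, expo_mem m⟩)‖ := by
        simp only [smul_sub, Finset.sum_sub_distrib, ← map_smul, ← map_sum, ← hfc]
        rw [← hc, Finsupp.sum]
    _ ≤ ∑ m ∈ c.support, ‖c m‖ * (ε / (C + 1)) := norm_sum_le_of_le _ fun m hm => by
        rw [norm_smul]
        gcongr
        exact hBm m hm
    _ = ε * (C / (C + 1)) := by
        rw [← Finset.sum_mul, ← hC]
        field_simp
    _ ≤ ε := mul_le_of_le_one_right hε.le (div_le_one_of_le₀ (by linarith) (by positivity))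

theorem exists_norm_sub_fejer_lt (f : AP k) {ε : ℝ} (hε : 0 < ε) :
    ∃ B : Finset (Fin k → ℝ), ‖(f : (Fin k → ℝ) →ᵇ ℂ) - fejer B f‖ < ε := by
  obtain ⟨p, hp, hfp⟩ := Metric.mem_closure_iff.1 (mem_AP_iff.1 f.2) (ε / 3) (by linarith)
  let p : AP k := ⟨p, mem_AP_iff.2 (subset_closure hp)⟩
  obtain ⟨B, hB, hpB⟩ := exists_norm_sub_fejer_le_of_mem_span (f := p) hp
    (show 0 < ε / 3 by linarith)
  have hsplit : (f : (Fin k → ℝ) →ᵇ ℂ) - fejer B f =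
      (f - p : (Fin k → ℝ) →ᵇ ℂ) + (p - fejer B p) - fejer B (f - p) := by
    rw [map_sub]
    abel
  refine ⟨B, ?_⟩
  calc ‖(f : (Fin k → ℝ) →ᵇ ℂ) - fejer B f‖
      ≤ ‖(f - p : (Fin k → ℝ) →ᵇ ℂ)‖ + ‖p - fejer B p‖ + ‖fejer B (f - p)‖ :=
        hsplit ▸ (norm_sub_le _ _).trans (add_le_add_left (norm_add_le _ _) _)
    _ < ε / 3 + ε / 3 + ε / 3 := by
        have hfp' : ‖(f - p : (Fin k → ℝ) →ᵇ ℂ)‖ < ε / 3 := by rwa [← dist_eq_norm]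
        have := (norm_fejer_le hB (f - p)).trans_lt hfp'
        linarith
    _ = ε := by ring

theorem eq_of_bohrCoeff_eq {f g : (Fin k → ℝ) →ᵇ ℂ} (hf : f ∈ AP k) (hg : g ∈ AP k)
    (h : ∀ l, bohrCoeff f l = bohrCoeff g l) : f = g := by
  refine sub_eq_zero.1 (norm_eq_zero.1 (le_antisymm (le_of_forall_pos_le_add fun ε hε => ?_)
    (norm_nonneg _)))
  obtain ⟨B, hB⟩ := exists_norm_sub_fejer_lt (⟨f, hf⟩ - ⟨g, hg⟩ : AP k) hε
  have hzero : fejer B (⟨f, hf⟩ - ⟨g, hg⟩ : AP k) = 0 := by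
    simp [map_sub, fejer_apply, h]
  rw [hzero, sub_zero] at hB
  exact hB.le.trans_eq (zero_add ε).symm

end BochnerFejer

/-! ### The algebra `AP^k_Σ` -/

section APOn

variable {Sig : AddSubmonoid (Fin k → ℝ)}

lemma APWOn_le_APOn : APWOn Sig ≤ APOn Sig := fun _ hf => ⟨hf.1, hf.2.2⟩

lemma expo_mem_APWOn (l : Sig) : expo (l : Fin k → ℝ) ∈ APWOn Sig := by
  refine ⟨expo_mem _, summable_of_ne_finset_zero (s := {(l : Fin k → ℝ)}) fun m hm => ?_,
    fun m hm => ?_⟩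
  · rw [bohrCoeff_expo, if_neg (by simpa [eq_comm] using hm), norm_zero]
  · obtain rfl : (l : Fin k → ℝ) = m := by
      by_contra hne
      exact hm (by rw [bohrCoeff_expo, if_neg hne])
    exact l.2

variable (Sig) in
/-- The trigonometric polynomials with frequencies in `Sig`, as functions. -/
def trigPoly : AddMonoidAlgebra ℂ Sig →ₐ[ℂ] (Fin k → ℝ) →ᵇ ℂ :=
  AddMonoidAlgebra.lift ℂ _ Sig
    { toFun := fun l => expo (l.toAdd : Fin k → ℝ)
      map_one' := expo_zero
      map_mul' := fun _ _ => expo_add _ _ }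

lemma trigPoly_apply (p : AddMonoidAlgebra ℂ Sig) :
    trigPoly Sig p = ∑ l ∈ p.coeff.support, p.coeff l • expo (l : Fin k → ℝ) :=
  AddMonoidAlgebra.lift_apply _ _

lemma trigPoly_single (l : Sig) (c : ℂ) :
    trigPoly Sig (AddMonoidAlgebra.single l c) = c • expo (l : Fin k → ℝ) :=
  AddMonoidAlgebra.lift_single _ _ _

lemma trigPoly_mem_APWOn (p : AddMonoidAlgebra ℂ Sig) : trigPoly Sig p ∈ APWOn Sig := by
  rw [trigPoly_apply]
  exact sum_mem fun l _ => (APWOn Sig).smul_mem (expo_mem_APWOn l) _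

lemma bohrCoeff_trigPoly (p : AddMonoidAlgebra ℂ Sig) (l : Sig) :
    bohrCoeff (trigPoly Sig p) l = p.coeff l := by
  classical
  let P : AP k := ∑ m ∈ p.coeff.support, p.coeff m • ⟨expo (m : Fin k → ℝ), expo_mem _⟩
  have hP : (P : (Fin k → ℝ) →ᵇ ℂ) = trigPoly Sig p := by
    rw [trigPoly_apply, AddSubmonoidClass.coe_finsetSum]
    rfl
  rw [← hP, ← bohrCoeffCLM_apply, map_sum]
  simp only [map_smul, bohrCoeffCLM_apply, bohrCoeff_expo, smul_eq_mul, Subtype.coe_inj, mul_ite,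
    mul_one, mul_zero, Finset.sum_ite_eq', Finsupp.mem_support_iff, ite_not]
  split_ifs with h
  exacts [h.symm, rfl]

lemma fejer_mem_range_trigPoly (B : Finset (Fin k → ℝ)) {f : AP k}
    (hf : (f : (Fin k → ℝ) →ᵇ ℂ) ∈ APOn Sig) : fejer B f ∈ (trigPoly Sig).range := by
  rw [fejer_apply]
  refine Subalgebra.smul_mem _ (sum_mem fun a _ => sum_mem fun b _ => ?_) _
  by_cases hab : a - b ∈ Sig
  · exact ⟨AddMonoidAlgebra.single ⟨a - b, hab⟩ _, trigPoly_single _ _⟩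
  · rw [not_not.1 fun hne => hab (hf.2 hne), zero_smul]
    exact zero_mem _

lemma isClosed_AP : IsClosed (AP k : Set ((Fin k → ℝ) →ᵇ ℂ)) :=
  Subalgebra.isClosed_topologicalClosure _

lemma isClosed_APOn : IsClosed (APOn Sig : Set ((Fin k → ℝ) →ᵇ ℂ)) := by
  have hclosed : IsClosed {f : AP k | ∀ l ∉ Sig, bohrCoeffCLM l f = 0} := by
    simp only [Set.ofPred_forall]
    exact isClosed_iInter fun l => isClosed_iInter fun _ =>
      isClosed_eq (bohrCoeffCLM l).continuous continuous_const
  convert isClosed_AP.isClosedEmbedding_subtypeVal.isClosedMap _ hclosed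
  ext f
  refine ⟨fun hf => ⟨⟨f, hf.1⟩, fun l hl => not_not.1 fun hne => hl (hf.2 hne), rfl⟩, ?_⟩
  rintro ⟨g, hg, rfl⟩
  exact ⟨g.2, fun l hl => by_contra fun hlS => hl (hg l hlS)⟩

instance : CompleteSpace (APOn Sig) := isClosed_APOn.completeSpace_coe

theorem isMonoidAlgebraCompletion_APOn :
    IsMonoidAlgebraCompletion
      ((trigPoly Sig).codRestrict (APOn Sig) fun p => APWOn_le_APOn (trigPoly_mem_APWOn p)) where
  denseRange f := by
    refine Metric.mem_closure_iff.2 fun ε hε => ?_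
    obtain ⟨B, hB⟩ := exists_norm_sub_fejer_lt (⟨f, f.2.1⟩ : AP k) hε
    obtain ⟨p, hp⟩ := fejer_mem_range_trigPoly B (f := ⟨f, f.2.1⟩) f.2
    refine ⟨_, ⟨p, rfl⟩, ?_⟩
    rwa [← hp, ← dist_eq_norm] at hB
  norm_of_le l := by
    change ‖trigPoly Sig (AddMonoidAlgebra.single l.toAdd 1)‖ ≤ 1
    rw [trigPoly_single, one_smul, norm_expo]
  norm_coeff_le p l := by
    rw [← bohrCoeff_trigPoly]
    exact norm_bohrCoeff_le (trigPoly_mem_APWOn p).1 l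

end APOn

/-! ### The algebra `APW^k_Σ` -/

lemma tsum_norm_le_of_hasSum_convolution {G R : Type*} [AddGroup G] [NormedRing R] {a b c : G → R}
    (ha : Summable fun l => ‖a l‖) (hb : Summable fun l => ‖b l‖)
    (hc : ∀ l, HasSum (fun m => a m * b (l - m)) (c l)) :
    ∑' l, ‖c l‖ ≤ (∑' l, ‖a l‖) * ∑' l, ‖b l‖ := by
  let e : G × G ≃ G × G :=
    (Equiv.prodComm G G).trans (Equiv.prodShear (Equiv.refl G) fun m => Equiv.subRight m)
  have hprod : Summable fun p : G × G => ‖a p.1‖ * ‖b p.2‖ :=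
    ha.mul_of_nonneg hb (fun _ => norm_nonneg _) fun _ => norm_nonneg _
  have hsum : HasSum (fun p : G × G => ‖a p.2‖ * ‖b (p.1 - p.2)‖)
      ((∑' l, ‖a l‖) * ∑' l, ‖b l‖) :=
    e.hasSum_iff.2 (ha.hasSum.mul hb.hasSum hprod)
  have hle (l : G) : ‖c l‖ ≤ ∑' m, ‖a m‖ * ‖b (l - m)‖ :=
    (hc l).norm_le_of_bounded (hsum.summable.prod_factor l).hasSum fun m => norm_mul_le _ _
  rw [← hsum.tsum_eq, hsum.summable.tsum_prod]
  exact (Summable.of_nonneg_of_le (fun _ => norm_nonneg _) hle hsum.summable.prod).tsum_le_tsum hle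
    hsum.summable.prod

/-- The algebra `APW^k_Σ`, as a type synonym which carries the norm `‖f‖_W` instead of the
supremum norm. -/
def Wiener (Sig : AddSubmonoid (Fin k → ℝ)) : Type := APWOn Sig

namespace Wiener

variable {Sig : AddSubmonoid (Fin k → ℝ)}

instance : CommRing (Wiener Sig) := inferInstanceAs (CommRing (APWOn Sig))

instance : Algebra ℂ (Wiener Sig) := inferInstanceAs (Algebra ℂ (APWOn Sig))

variable (Sig) in
/-- The Bohr-Fourier coefficients of a function in `APW^k_Σ`. -/
def coeffs : Wiener Sig →ₗ[ℂ] lp (fun _ : Sig => ℂ) 1 where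
  toFun f := ⟨fun l => bohrCoeff f.1 l, memℓp_gen <| by
    simp only [ENNReal.toReal_one, Real.rpow_one]
    exact f.2.2.1.comp_injective Subtype.val_injective⟩
  map_add' f g := Subtype.ext (funext fun l => bohrCoeff_add f.2.1 g.2.1 l)
  map_smul' c f := Subtype.ext (funext fun l => bohrCoeff_smul c f.2.1 l)

lemma coeffs_apply (f : Wiener Sig) (l : Sig) : coeffs Sig f l = bohrCoeff f.1 l := rfl

lemma bohrCoeff_eq_zero (f : Wiener Sig) {l : Fin k → ℝ} (hl : l ∉ Sig) : bohrCoeff f.1 l = 0 :=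
  not_not.1 fun hne => hl (f.2.2.2 hne)

lemma coeffs_injective : Function.Injective (coeffs Sig) := fun f g h =>
  Subtype.ext <| eq_of_bohrCoeff_eq f.2.1 g.2.1 fun l => by
    by_cases hl : l ∈ Sig
    · exact congrFun (congrArg Subtype.val h) ⟨l, hl⟩
    · rw [bohrCoeff_eq_zero f hl, bohrCoeff_eq_zero g hl]

lemma coeffs_surjective : Function.Surjective (coeffs Sig) := fun a => by
  have ha : Summable fun l : Sig => ‖a l‖ := by
    simpa using (lp.memℓp a).summable (by simp)
  have : CompleteSpace (AP k) := isClosed_AP.completeSpace_coe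
  let F (l : Sig) : AP k := a l • ⟨expo l, expo_mem _⟩
  have hF : Summable F := .of_norm_bounded ha fun l => by
    rw [norm_smul, show ‖(⟨expo l, expo_mem _⟩ : AP k)‖ = 1 from norm_expo _, mul_one]
  let f : AP k := ∑' l, F l
  have hf (m : Fin k → ℝ) : HasSum (fun l : Sig => if (l : Fin k → ℝ) = m then a l else 0)
      (bohrCoeff f m) := by
    refine (hF.hasSum.mapL (bohrCoeffCLM m)).congr_fun fun l => ?_
    rw [map_smul, bohrCoeffCLM_apply, bohrCoeff_expo, smul_ite, smul_eq_mul, mul_one, smul_zero]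
  have hf_mem (l : Sig) : bohrCoeff (f : (Fin k → ℝ) →ᵇ ℂ) l = a l := by
    refine (hf l).unique ?_
    convert hasSum_single l fun m hm => if_neg (Subtype.coe_injective.ne hm)
    exact (if_pos rfl).symm
  have hf_notMem (m : Fin k → ℝ) (hm : m ∉ Sig) : bohrCoeff f m = 0 := by
    refine (hf m).unique ?_
    convert hasSum_zero with l
    exact if_neg fun h : (l : Fin k → ℝ) = m => hm (h ▸ l.2)
  have hf_summable : Summable fun m : Fin k → ℝ => ‖bohrCoeff f m‖ := by
    refine (Subtype.val_injective.summable_iff fun m hm => ?_).1 (ha.congr fun l => ?_)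
    · rw [hf_notMem m fun h => hm ⟨⟨m, h⟩, rfl⟩, norm_zero]
    · rw [Function.comp_apply, hf_mem]
  exact ⟨⟨f, f.2, hf_summable, fun m hm => by_contra fun h => hm (hf_notMem m h)⟩,
    lp.ext (funext hf_mem)⟩

lemma norm_coeffs (f : Wiener Sig) : ‖coeffs Sig f‖ = ∑' l, ‖bohrCoeff f.1 l‖ := by
  rw [lp.norm_eq_tsum_rpow (by simp)]
  simp only [ENNReal.toReal_one, Real.rpow_one, div_one, coeffs_apply]
  refine tsum_subtype_eq_of_support_subset (f := fun l => ‖bohrCoeff f.1 l‖)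
    (s := (Sig : Set (Fin k → ℝ))) fun l hl => ?_
  exact by_contra fun h => hl (norm_eq_zero.2 (bohrCoeff_eq_zero f h))

instance : NormedCommRing (Wiener Sig) where
  __ := NormedAddCommGroup.induced (Wiener Sig) _ (coeffs Sig) coeffs_injective
  __ := (inferInstance : CommRing (Wiener Sig))
  norm_mul_le f g := by
    change ‖coeffs Sig (f * g)‖ ≤ ‖coeffs Sig f‖ * ‖coeffs Sig g‖
    simp only [norm_coeffs]
    exact tsum_norm_le_of_hasSum_convolution f.2.2.1 g.2.2.1 (hasSum_bohrCoeff_mul f.2.1 g.2.1)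

instance : NormedAlgebra ℂ (Wiener Sig) where
  norm_smul_le c f := by
    change ‖coeffs Sig (c • f)‖ ≤ ‖c‖ * ‖coeffs Sig f‖
    rw [map_smul, norm_smul]

variable (Sig) in
/-- The algebra `APW^k_Σ` is isometric to `ℓ¹(Σ)`. -/
def coeffsEquiv : Wiener Sig ≃ₗᵢ[ℂ] lp (fun _ : Sig => ℂ) 1 where
  toLinearEquiv := .ofBijective (coeffs Sig) ⟨coeffs_injective, coeffs_surjective⟩
  norm_map' _ := rfl

instance : CompleteSpace (Wiener Sig) :=
  (coeffsEquiv Sig).isometry.isUniformInducing.completeSpace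
    ((coeffsEquiv Sig).surjective.range_eq ▸ isComplete_univ)

variable (Sig) in
/-- The trigonometric polynomials with frequencies in `Sig`, as elements of `APW^k_Σ`. -/
def trigPoly : AddMonoidAlgebra ℂ Sig →ₐ[ℂ] Wiener Sig :=
  (AlmostPeriodic.trigPoly Sig).codRestrict (APWOn Sig) trigPoly_mem_APWOn

lemma coeffsEquiv_trigPoly (p : AddMonoidAlgebra ℂ Sig) (l : Sig) :
    coeffsEquiv Sig (trigPoly Sig p) l = p.coeff l := bohrCoeff_trigPoly p l

open scoped Classical in
lemma coeffsEquiv_trigPoly_single (l : Sig) (c : ℂ) :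
    coeffsEquiv Sig (trigPoly Sig (AddMonoidAlgebra.single l c)) =
      lp.single (E := fun _ : Sig => ℂ) 1 l c := by
  refine lp.ext (funext fun m => ?_)
  rw [coeffsEquiv_trigPoly, lp.single_apply]
  simp [Finsupp.single_apply, Pi.single_apply, eq_comm]

lemma hasSum_trigPoly_single (f : Wiener Sig) :
    HasSum (fun l => trigPoly Sig (AddMonoidAlgebra.single l (coeffsEquiv Sig f l))) f := by
  classical
  rw [← (coeffsEquiv Sig).toContinuousLinearEquiv.hasSum']
  refine (lp.hasSum_single (by simp) (coeffsEquiv Sig f)).congr_fun fun l => ?_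
  exact coeffsEquiv_trigPoly_single l _

theorem isMonoidAlgebraCompletion : IsMonoidAlgebraCompletion (trigPoly Sig) where
  denseRange f := by
    refine mem_closure_of_tendsto (hasSum_trigPoly_single f) (Eventually.of_forall fun s => ?_)
    exact ⟨∑ l ∈ s, AddMonoidAlgebra.single l (coeffsEquiv Sig f l), map_sum _ _ _⟩
  norm_of_le l := by
    classical
    change ‖trigPoly Sig (AddMonoidAlgebra.single l.toAdd 1)‖ ≤ 1
    rw [← (coeffsEquiv Sig).norm_map, coeffsEquiv_trigPoly_single, lp.norm_single (by simp),
      norm_one]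
  norm_coeff_le p l := by
    rw [← coeffsEquiv_trigPoly, ← (coeffsEquiv Sig).norm_map]
    exact lp.norm_apply_le_norm (by simp) _ l

end Wiener

end AlmostPeriodic

end

theorem theorem3p1_general (k : ℕ) (C : PointedCone ℝ (Fin k → ℝ)) (hC : C.toConvexCone.Salient)
    (Sig : AddSubmonoid (Fin k → ℝ)) (hSig : (Sig : Set (Fin k → ℝ)) ⊆ C) :
    ContractibleSpace (AlmostPeriodic.MaximalIdealSpace (AlmostPeriodic.APOn Sig)) ∧
      ContractibleSpace (AlmostPeriodic.MaximalIdealSpace (AlmostPeriodic.APWOn Sig)) := by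
  have hcontr : ContractibleSpace (AlmostPeriodic.Semichar Sig) :=
    AlmostPeriodic.Semichar.contractibleSpace_of_salient rfl Sig.subtype
      (fun _ hl => Subtype.ext hl) hC fun l => hSig l.2
  exact ⟨AlmostPeriodic.isMonoidAlgebraCompletion_APOn.homeomorphSemichar.contractibleSpace,
    AlmostPeriodic.Wiener.isMonoidAlgebraCompletion.homeomorphSemichar.contractibleSpace⟩

theorem theorem3p1 (k : ℕ) (S : Set (Fin k → ℝ)) (hS : AlmostPeriodic.IsHalfspace S)
    (Sig : AddSubmonoid (Fin k → ℝ)) (hSig : (Sig : Set (Fin k → ℝ)) ⊆ S) :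
    ContractibleSpace (AlmostPeriodic.MaximalIdealSpace (AlmostPeriodic.APOn Sig)) ∧
      ContractibleSpace (AlmostPeriodic.MaximalIdealSpace (AlmostPeriodic.APWOn Sig)) :=
  theorem3p1_general k hS.toPointedCone hS.salient Sig hSig
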